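/- Let $\Lambda\subset\mathbf{R}^{24}$ be the Leech lattice, in the scale in which its minimal vectors $v$ satisfy $v\cdot v=32$ (so that $(5,1^{23})\in\Lambda$ in the standard coordinates), and for an integer $n\ge 0$ let $\Lambda(n)=\{v\in\Lambda : v\cdot v=16n\}$, so that $\Lambda(2)$ is the set of minimal vectors. Let $v\in\Lambda(3)$ (for example $v=(5,1^{23})$), and let $$\mathcal{U}_{552}=\{\pm(y-z) : y,z\in\Lambda(2),\ y+z=v\}.$$ Then $\mathcal{U}_{552}$ consists of $276$ antipodal pairs of vectors of $\Lambda(5)$, all orthogonal to $v$, and these pairs span $276$ equiangular lines (with common angle $\arccos(1/5)$) in the $23$-dimensional space $v^{\perp}$. Let $\Lambda_{276}$ be the sublattice of $\Lambda$ generated by $\mathcal{U}_{552}$. Then there exists an $8$-dimensional subspace $W$ of $\mathbf{R}^{24}$ such that the orthogonal projection of $\Lambda_{276}$ onto $W$ is, after multiplication by a suitable positive scalar and a linear isometry $W\to\mathbf{R}^8$, equal to the $E_8$ lattice $$E_8=\Big\{x\in\mathbf{Z}^8\cup(\mathbf{Z}+\tfrac12)^8 : \textstyle\sum_i x_i\in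 2\mathbf{Z}\Big\}.$$ -/

import Mathlib

open scoped RealInnerProductSpace

/-- The extended binary Golay code, as the extended quadratic residue code of length 24.
The coordinates are the points of the projective line over the field with 23 elements: the
coordinate `i < 23` is the residue `i`, and the coordinate `23` is the point at infinity. The code is
spanned by the indicator vectors of the 23 translates of the set consisting of the
quadratic non-residues (`0` counts as a square) and the point at infinity. -/
def golayCode : Submodule (ZMod 2) (Fin 24 → ZMod 2) :=
  Submodule.span (ZMod 2) (Set.range fun (a : ZMod 23) (i : Fin 24) =>
    if i = 23 ∨ ¬ IsSquare ((i.val : ZMod 23) - a) then (1 : ZMod 2) else 0)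

/-- The Leech lattice in `ℝ²⁴`, in the scale in which minimal vectors have norm `v·v = 32`: the
integral vectors `x` for which there is an `m` with `x i = m + 2 * k i` for all `i`, such that
the positions where `k i` is odd form a word of the Golay code, and
`∑ i, x i ≡ 4 * m (mod 8)`. -/
def leechLattice : Submodule ℤ (EuclideanSpace ℝ (Fin 24)) where
  carrier := {x | ∃ (m : ℤ) (k : Fin 24 → ℤ),
    (∀ i, x i = ((m + 2 * k i : ℤ) : ℝ)) ∧
    (fun i => ((k i : ℤ) : ZMod 2)) ∈ golayCode ∧
    (∑ i, (m + 2 * k i)) ≡ 4 * m [ZMOD 8]}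
  zero_mem' := ⟨0, 0, by simp, by convert golayCode.zero_mem using 1; funext i; simp, by simp⟩
  add_mem' := by
    rintro x y ⟨m, k, hx, hk, hm⟩ ⟨n, l, hy, hl, hn⟩
    refine ⟨m + n, k + l, fun i => ?_, ?_, ?_⟩
    · rw [PiLp.add_apply, hx, hy, Pi.add_apply]
      push_cast
      ring
    · convert golayCode.add_mem hk hl using 1
      funext i
      simp
    · convert hm.add hn using 1
      · rw [← Finset.sum_add_distrib]
        refine Finset.sum_congr rfl fun i _ => ?_
        rw [Pi.add_apply]
        ring
      · ring
  smul_mem' := by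
    rintro c x ⟨m, k, hx, hk, hm⟩
    refine ⟨c * m, fun i => c * k i, fun i => ?_, ?_, ?_⟩
    · rw [PiLp.smul_apply, hx, zsmul_eq_mul]
      push_cast
      ring
    · convert golayCode.smul_mem (c : ZMod 2) hk using 1
      funext i
      simp
    · convert hm.mul_left c using 1
      · rw [Finset.mul_sum]
        refine Finset.sum_congr rfl fun i _ => ?_
        ring
      · ring

/-- `Λ(n)`: the vectors `v` of the Leech lattice with `v·v = 16 n`. In particular `Λ(2)` is the
set of vectors of minimal norm. -/
def leechShell (n : ℕ) : Set (EuclideanSpace ℝ (Fin 24)) :=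
  {x | x ∈ leechLattice ∧ ⟪x, x⟫ = 16 * (n : ℝ)}

/-- The set of all `±(y - z)`, where `y` and `z` are minimal vectors of the Leech lattice
with `v = y + z`. -/
def differenceSet (v : EuclideanSpace ℝ (Fin 24)) : Set (EuclideanSpace ℝ (Fin 24)) :=
  {u | ∃ y ∈ leechShell 2, ∃ z ∈ leechShell 2, v = y + z ∧ (u = y - z ∨ u = -(y - z))}

/-- The sublattice of the Leech lattice generated by `differenceSet v`. -/
def lattice276 (v : EuclideanSpace ℝ (Fin 24)) : Submodule ℤ (EuclideanSpace ℝ (Fin 24)) :=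
  Submodule.span ℤ (differenceSet v)

/-- The `E₈` lattice in `ℝ⁸`: the vectors whose coordinates are all integers or all halves of odd
integers, with even coordinate sum. -/
def latticeE8 : Set (EuclideanSpace ℝ (Fin 8)) :=
  {x | ((∀ i, ∃ a : ℤ, x i = (a : ℝ)) ∨ (∀ i, ∃ a : ℤ, x i = (a : ℝ) + 1 / 2)) ∧
    ∃ b : ℤ, ∑ i, x i = 2 * (b : ℝ)}

/-!
The proof moves the given vector `v` of `Λ(3)` by automorphisms of the Leech lattice, and reads off
each invariant assertion at the representative where it is easiest.

*General facts.* The lattice has inner products in `8ℤ`, norms in `16ℤ` and minimal norm 32. If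
`v = y + z` with `y`, `z` minimal, then `y · v = 24`; for two such `y`, `y'` with `y'` neither `y`
nor `v - y`, minimality applied to `y - y'` and to `y - (v - y')` forces `y · y' ∈ {8, 16}`, so that
the differences `2y - v` and `2y' - v` have inner product `±16`, one fifth of their norm 80
(`abs_inner_of_mem_differenceSet`).

*Transitivity* (`leechEquiv_fiveVec`). Three kinds of automorphisms are used: permutations in
`PSL₂(23)`, sign changes on words of the Golay code, and the map attached to one sextet, which
reflects every tetrad block in its all-ones vector and then changes the signs on one tetrad. If `v`
has even coordinates, its word is neither zero nor full, so a translate of the tetrad meets it in an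
odd number of points, and the sextet map makes the coordinates odd. A sign change then makes
all coordinates 1 modulo 4, which leaves the shapes `(5, 1²³)` and `(-3³, 1²¹)`.
As any three points can be moved to `∞, 0, 1`, which lie in the tetrad, the sextet map turns the
second shape into the first up to sign. So every `v` is equivalent to `(1²³, 5)`.

*Counting* at `v = (1²³, 5)` (`ncard_differenceSet_fiveVec`). Exactly one of `y`, `z` is even, and
the even ones are the 253 vectors `(2⁸, 0¹⁶)` on an octad through `∞` and the 23 vectors
`(4², 0²²)` on a pair through `∞`.

*The projection to `E₈`* (`projectsToE8_trioVec`) is best seen at a vector `v` of shape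
`(4, 2⁷, -2, 0¹⁵)` that vanishes on an octad `O`. Projecting to the coordinates in `O` kills `v`, so
the image of the lattice generated by the `2y - v` lies in twice the projection of the Leech
lattice, which is `4 E₈`; conversely nine explicit `y` project to generators of `2 E₈`.
-/

/-! ### The binary words of the Golay code -/

/-- The word of length 24 over the field with two elements whose coordinate `i` is the binary digit
of `w` of value `2 ^ i`. Words are handled as natural numbers wherever the kernel computes with
them. -/
def bitVec (w : ℕ) : Fin 24 → ZMod 2 := fun i => if w.testBit i then 1 else 0

lemma bitVec_zero : bitVec 0 = 0 := by
  funext i; simp [bitVec]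

lemma bitVec_xor (a b : ℕ) : bitVec (a ^^^ b) = bitVec a + bitVec b := by
  funext i
  simp only [bitVec, Nat.testBit_xor, Pi.add_apply]
  cases a.testBit i <;> cases b.testBit i <;> simp
  decide

lemma bitVec_inj {a b : ℕ} (ha : a < 2 ^ 24) (hb : b < 2 ^ 24) (h : bitVec a = bitVec b) :
    a = b := by
  refine Nat.eq_of_testBit_eq fun i => ?_
  by_cases hi : i < 24
  · have := congrFun h ⟨i, hi⟩
    simp only [bitVec] at this
    cases h1 : a.testBit i <;> cases h2 : b.testBit i <;> simp_all
  · have h24 : 2 ^ 24 ≤ 2 ^ i := Nat.pow_le_pow_right (by norm_num) (by omega)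
    rw [Nat.testBit_lt_two_pow (ha.trans_le h24), Nat.testBit_lt_two_pow (hb.trans_le h24)]

/-- The words that span the Golay code by definition: entry `a` is the translate by `a`. -/
def golayGenerators : List ℕ :=
  [16436384, 16095553, 15413891, 14050567, 11323919, 14259230, 11741245, 15093882, 13410549,
    10043883, 11699158, 15009708, 13242201, 9707187, 11025766, 13662924, 10548633, 12708658,
    8640101, 8891594, 9394580, 10400552, 12412496]

/-- The basis of the Golay code in reduced echelon form, with pivots the leading binary digits. -/
def golayBasis : List ℕ :=
  [8391797, 4196943, 2101096, 1050548, 525274, 262637, 133817, 69395, 36294, 18147, 10558, 5279]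

/-- The sum of a list of words. -/
def xorAll (l : List ℕ) : ℕ := l.foldr (· ^^^ ·) 0

/-- Elimination: clears in `w` the leading digits of the members of a list, one after the other.
The remainder differs from `w` by a sum of members of the list, so that a zero remainder certifies
membership in the span. -/
def golayReduce (w : ℕ) : List ℕ → ℕ
  | [] => w
  | b :: l => golayReduce (if w.testBit b.log2 then b ^^^ w else w) l

/-- All sums of sublists of a list of words. -/
def xorSpan : List ℕ → List ℕ
  | [] => [0]
  | b :: l => xorSpan l ++ (xorSpan l).map (b ^^^ ·)

/-- All 4096 words of the Golay code. -/
def golayWords : List ℕ := xorSpan golayBasis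

/-- The sums of `w` with the members of `xorSpan l` that satisfy `p`, computed by a recursion of
depth `l.length`, so that the kernel can evaluate it. -/
def xorSpanFilter (p : ℕ → Bool) : List ℕ → ℕ → List ℕ
  | [], w => bif p w then [w] else []
  | b :: l, w => xorSpanFilter p l w ++ xorSpanFilter p l (b ^^^ w)

lemma mem_xorSpanFilter {p : ℕ → Bool} {u : ℕ} : ∀ (l : List ℕ) (w : ℕ),
    u ∈ xorSpanFilter p l w ↔ (∃ x ∈ xorSpan l, u = x ^^^ w) ∧ p u = true
  | [], w => by
    simp only [xorSpanFilter, xorSpan, List.mem_singleton]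
    cases h : p w
    · simp only [cond_false, List.not_mem_nil, false_iff, not_and, Bool.not_eq_true]
      rintro ⟨x, rfl, rfl⟩
      simpa using h
    · simp only [cond_true, List.mem_singleton]
      constructor
      · rintro rfl
        exact ⟨⟨0, rfl, by simp⟩, h⟩
      · rintro ⟨⟨x, rfl, rfl⟩, -⟩
        simp
  | b :: l, w => by
    rw [xorSpanFilter, List.mem_append, mem_xorSpanFilter l, mem_xorSpanFilter l, ← or_and_right,
      xorSpan]
    refine and_congr_left fun _ => ?_
    simp only [List.mem_append, List.mem_map, or_and_right, exists_or]
    refine or_congr_right ?_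
    constructor
    · rintro ⟨x, hx, rfl⟩
      exact ⟨b ^^^ x, ⟨x, hx, rfl⟩, by rw [Nat.xor_comm b x, Nat.xor_assoc]⟩
    · rintro ⟨_, ⟨x, hx, rfl⟩, rfl⟩
      exact ⟨x, hx, by rw [Nat.xor_comm b x, Nat.xor_assoc]⟩

lemma forall_mem_golayWords {p : ℕ → Bool}
    (h : (xorSpanFilter (fun w => !p w) golayBasis 0).isEmpty = true) :
    ∀ w ∈ golayWords, p w = true := by
  intro w hw
  by_contra hp
  rw [List.isEmpty_iff] at h
  have := (mem_xorSpanFilter (p := fun w => !p w) golayBasis 0).2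
    ⟨⟨w, hw, (Nat.xor_zero w).symm⟩, by simpa using hp⟩
  simp [h] at this

lemma gen_eq_bitVec : ∀ (a : ZMod 23) (i : Fin 24),
    (if i = 23 ∨ ¬ IsSquare ((i.val : ZMod 23) - a) then (1 : ZMod 2) else 0) =
      bitVec (golayGenerators.getD a.val 0) i := by
  decide +kernel

/-! ### Membership, duality and weights in the Golay code -/

lemma bitVec_xorAll_mem {C : Submodule (ZMod 2) (Fin 24 → ZMod 2)} :
    ∀ l : List ℕ, (∀ b ∈ l, bitVec b ∈ C) → bitVec (xorAll l) ∈ C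
  | [], _ => by simp [xorAll, bitVec_zero]
  | b :: l, h => by
    have := bitVec_xorAll_mem l fun b hb => h b (List.mem_cons_of_mem _ hb)
    simpa [xorAll, bitVec_xor] using C.add_mem (h b (by simp)) this

lemma bitVec_mem_of_golayReduce {C : Submodule (ZMod 2) (Fin 24 → ZMod 2)} :
    ∀ (l : List ℕ) (w : ℕ), (∀ b ∈ l, bitVec b ∈ C) → golayReduce w l = 0 → bitVec w ∈ C
  | [], w, _, hw => by
    rw [golayReduce] at hw
    rw [hw, bitVec_zero]
    exact C.zero_mem
  | b :: l, w, h, hw => by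
    rw [golayReduce] at hw
    have := bitVec_mem_of_golayReduce l _ (fun b hb => h b (List.mem_cons_of_mem _ hb)) hw
    split_ifs at this
    · rw [bitVec_xor] at this
      exact (C.add_mem_iff_right (h b (by simp))).1 this
    · exact this

lemma mem_span_bitVec_iff (l : List ℕ) : ∀ c : Fin 24 → ZMod 2,
    c ∈ Submodule.span (ZMod 2) (bitVec '' {b | b ∈ l}) ↔ ∃ w ∈ xorSpan l, bitVec w = c := by
  induction l with
  | nil => intro c; simp [xorSpan, bitVec_zero, eq_comm]
  | cons b l ih =>
    intro c
    have hs : bitVec '' {a | a ∈ b :: l} = insert (bitVec b) (bitVec '' {a | a ∈ l}) := by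
      rw [← Set.image_insert_eq]
      congr 1
      ext a
      simp
    rw [hs, Submodule.mem_span_insert]
    constructor
    · rintro ⟨a, z, hz, rfl⟩
      obtain ⟨w, hw, rfl⟩ := (ih z).1 hz
      obtain rfl | rfl : a = 0 ∨ a = 1 := by revert a; decide
      · exact ⟨w, List.mem_append_left _ hw, by simp⟩
      · exact ⟨b ^^^ w, List.mem_append_right _ (List.mem_map_of_mem hw), by simp [bitVec_xor]⟩
    · rintro ⟨w, hw, rfl⟩
      rcases List.mem_append.1 hw with h | h
      · exact ⟨0, bitVec w, (ih _).2 ⟨w, h, rfl⟩, by simp⟩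
      · obtain ⟨u, hu, rfl⟩ := List.mem_map.1 h
        exact ⟨1, bitVec u, (ih _).2 ⟨u, hu, rfl⟩, by simp [bitVec_xor]⟩

lemma golayCode_eq_span_generators :
    golayCode = Submodule.span (ZMod 2) (bitVec '' {b | b ∈ golayGenerators}) := by
  rw [golayCode]
  congr 1
  ext c
  constructor
  · rintro ⟨a, rfl⟩
    have ha : a.val < golayGenerators.length := ZMod.val_lt a
    refine ⟨golayGenerators.getD a.val 0, ?_, ?_⟩
    · rw [List.getD_eq_getElem _ _ ha]
      exact List.getElem_mem ha
    · funext i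
      exact (gen_eq_bitVec a i).symm
  · rintro ⟨b, hb, rfl⟩
    obtain ⟨n, hn, rfl⟩ := List.getElem_of_mem hb
    refine ⟨((n : ℕ) : ZMod 23), ?_⟩
    funext i
    have h : ((n : ℕ) : ZMod 23).val = n := ZMod.val_natCast_of_lt hn
    simp only [gen_eq_bitVec, h]
    rw [List.getD_eq_getElem _ _ hn]

lemma golayCode_eq_span_basis :
    golayCode = Submodule.span (ZMod 2) (bitVec '' {b | b ∈ golayBasis}) := by
  rw [golayCode_eq_span_generators]
  apply le_antisymm <;> rw [Submodule.span_le]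
  · rintro _ ⟨b, hb, rfl⟩
    refine bitVec_mem_of_golayReduce golayBasis b
      (fun b hb => Submodule.subset_span ⟨b, hb, rfl⟩) ?_
    have h : ∀ b ∈ golayGenerators, golayReduce b golayBasis = 0 := by decide +kernel
    exact h b hb
  · rintro _ ⟨b, hb, rfl⟩
    -- The binary digits of `m` tell which of the first twelve generators sum to `b`.
    have h : ∀ b ∈ golayBasis, ∃ m ∈ [3189, 1501, 2209, 3010, 1505, 3426, 876, 1131, 2170, 1085,
        2129, 3002], b = xorAll (((List.range 12).filter (Nat.testBit m)).map
          fun a => golayGenerators.getD a 0) := by decide +kernel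
    obtain ⟨m, -, rfl⟩ := h b hb
    refine bitVec_xorAll_mem _ fun b hb => Submodule.subset_span ⟨b, ?_, rfl⟩
    obtain ⟨a, ha, rfl⟩ := List.mem_map.1 hb
    have ha' : a < golayGenerators.length :=
      (List.mem_range.1 (List.mem_filter.1 ha).1).trans (by decide)
    rw [List.getD_eq_getElem _ _ ha']
    exact List.getElem_mem ha'

/-- The list `golayWords` enumerates the Golay code. -/
lemma mem_golayCode_iff (c : Fin 24 → ZMod 2) :
    c ∈ golayCode ↔ ∃ w ∈ golayWords, bitVec w = c := by
  rw [golayCode_eq_span_basis, mem_span_bitVec_iff, golayWords]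

lemma bitVec_mem_golayCode {w : ℕ} (h : golayReduce w golayBasis = 0) : bitVec w ∈ golayCode := by
  rw [golayCode_eq_span_basis]
  exact bitVec_mem_of_golayReduce golayBasis w (fun b hb => Submodule.subset_span ⟨b, hb, rfl⟩) h

lemma ones_mem_golayCode : (1 : Fin 24 → ZMod 2) ∈ golayCode := by
  have h : (1 : Fin 24 → ZMod 2) = bitVec (2 ^ 24 - 1) := by decide
  rw [h]
  exact bitVec_mem_golayCode (by decide +kernel)

/-- The Golay code is self-orthogonal. -/
lemma golayCode_dot {c d : Fin 24 → ZMod 2} (hc : c ∈ golayCode) (hd : d ∈ golayCode) :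
    ∑ i, c i * d i = 0 := by
  have key : ∀ a ∈ golayBasis, ∀ b ∈ golayBasis, ∑ i, bitVec a i * bitVec b i = 0 := by
    decide +kernel
  rw [golayCode_eq_span_basis] at hc hd
  induction hc, hd using Submodule.span_induction₂ with
  | mem_mem x y hx hy =>
    obtain ⟨a, ha, rfl⟩ := hx
    obtain ⟨b, hb, rfl⟩ := hy
    exact key a ha b hb
  | zero_left => simp
  | zero_right => simp
  | add_left x y z _ _ _ h1 h2 =>
    simp only [Pi.add_apply, add_mul, Finset.sum_add_distrib, h1, h2, add_zero]
  | add_right x y z _ _ _ h1 h2 =>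
    simp only [Pi.add_apply, mul_add, Finset.sum_add_distrib, h1, h2, add_zero]
  | smul_left r x y _ _ h =>
    simp only [Pi.smul_apply, smul_eq_mul, mul_assoc, ← Finset.mul_sum, h, mul_zero]
  | smul_right r x y _ _ h =>
    simp only [Pi.smul_apply, smul_eq_mul, mul_left_comm, ← Finset.mul_sum, h, mul_zero]

/-- The number of digits 1 among the `n` least significant binary digits of `w`. -/
def popCount (w : ℕ) : ℕ → ℕ
  | 0 => 0
  | n + 1 => popCount w n + (w >>> n) % 2

/-- The Hamming weight of a binary word. -/
def weight (c : Fin 24 → ZMod 2) : ℕ := ∑ i, (c i).val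

lemma popCount_eq_sum (w n : ℕ) :
    popCount w n = ∑ i : Fin n, (if w.testBit i then (1 : ZMod 2) else 0).val := by
  induction n with
  | zero => simp [popCount]
  | succ n ih =>
    rw [popCount, Fin.sum_univ_castSucc, ih]
    congr 1
    have : (w >>> n) % 2 = (w.testBit n).toNat := by
      rw [Nat.toNat_testBit, Nat.shiftRight_eq_div_pow]
    rw [this]
    simp only [Fin.val_last]
    rcases Bool.eq_false_or_eq_true (w.testBit n) with h | h <;> simp [h]
    decide

lemma weight_bitVec (w : ℕ) : weight (bitVec w) = popCount w 24 :=
  (popCount_eq_sum w 24).symm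

lemma weight_golayCode {c : Fin 24 → ZMod 2} (hc : c ∈ golayCode) :
    weight c ∈ [0, 8, 12, 16, 24] := by
  have key := forall_mem_golayWords
    (p := fun w => ([0, 8, 12, 16, 24] : List ℕ).elem (popCount w 24)) (by decide +kernel)
  obtain ⟨w, hw, rfl⟩ := (mem_golayCode_iff c).1 hc
  rw [weight_bitVec]
  simpa using key w hw

lemma weight_eq_zero {c : Fin 24 → ZMod 2} (h : weight c = 0) : c = 0 := by
  funext i
  exact (ZMod.val_eq_zero _).1 ((Finset.sum_eq_zero_iff.1 h) i (Finset.mem_univ i))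

/-- There are 253 octads through the point at infinity. -/
lemma ncard_octads_infinity :
    {c | c ∈ golayCode ∧ weight c = 8 ∧ c 23 = 1}.ncard = 253 := by
  let p : ℕ → Bool := fun w => w.testBit 23 && (popCount w 24).beq 8
  have hset : {c | c ∈ golayCode ∧ weight c = 8 ∧ c 23 = 1} =
      bitVec '' ((xorSpanFilter p golayBasis 0).toFinset : Set ℕ) := by
    ext c
    simp only [Set.mem_ofPred_eq, Set.mem_image, Finset.mem_coe, List.mem_toFinset,
      mem_xorSpanFilter, mem_golayCode_iff]
    constructor
    · rintro ⟨⟨w, hw, rfl⟩, h8, h23⟩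
      refine ⟨w, ⟨⟨w, hw, (Nat.xor_zero w).symm⟩, ?_⟩, rfl⟩
      rw [weight_bitVec] at h8
      have : w.testBit 23 = true := by
        by_contra h
        simp [bitVec, h] at h23
      simp [p, h8, this]
    · rintro ⟨w, ⟨⟨x, hx, hwx⟩, h⟩, rfl⟩
      rw [Nat.xor_zero] at hwx
      subst hwx
      simp only [p, Bool.and_eq_true] at h
      exact ⟨⟨w, hx, rfl⟩, by rw [weight_bitVec]; exact Nat.eq_of_beq_eq_true h.2,
        by simp [bitVec, h.1]⟩
  have hlt := forall_mem_golayWords (p := fun w => w.blt (2 ^ 24)) (by decide +kernel)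
  have hn : (xorSpanFilter p golayBasis 0).Nodup := by decide +kernel
  rw [hset, Set.InjOn.ncard_image, Set.ncard_coe_finset, List.toFinset_card_of_nodup hn]
  · decide +kernel
  · intro a ha b hb h
    simp only [Finset.mem_coe, List.mem_toFinset, mem_xorSpanFilter, Nat.xor_zero,
      exists_eq_right'] at ha hb
    exact bitVec_inj (by simpa using hlt a ha.1) (by simpa using hlt b hb.1) h

/-! ### Automorphisms of the Golay code -/

/-- The permutations of the coordinates that preserve the Golay code (the Mathieu group `M₂₄`). -/
def golayAut : Subgroup (Equiv.Perm (Fin 24)) where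
  carrier := {π | ∀ c, c ∘ π ∈ golayCode ↔ c ∈ golayCode}
  one_mem' := fun c => by simp
  mul_mem' := by
    intro π ρ hπ hρ c
    rw [← hπ c, ← hρ (c ∘ π)]
    rfl
  inv_mem' := by
    intro π hπ c
    rw [← hπ (c ∘ ⇑π⁻¹)]
    rw [Function.comp_assoc, ← Equiv.Perm.coe_mul, inv_mul_cancel, Equiv.Perm.coe_one,
      Function.comp_id]

/-- As a permutation has finite order, it suffices that it maps the code into itself. -/
lemma mem_golayAut_of_forall {π : Equiv.Perm (Fin 24)} (h : ∀ c ∈ golayCode, c ∘ π ∈ golayCode) :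
    π ∈ golayAut := by
  have hpow : ∀ n : ℕ, ∀ c ∈ golayCode, c ∘ ⇑(π ^ n) ∈ golayCode := by
    intro n
    induction n with
    | zero => intro c hc; simpa using hc
    | succ n ih =>
      intro c hc
      rw [pow_succ, Equiv.Perm.coe_mul, ← Function.comp_assoc]
      exact h _ (ih c hc)
  intro c
  refine ⟨fun hc => ?_, h c⟩
  obtain ⟨n, hn⟩ : ∃ n : ℕ, π * π ^ n = 1 := by
    refine ⟨orderOf π - 1, ?_⟩
    rw [← pow_succ', Nat.sub_add_cancel (orderOf_pos π), pow_orderOf_eq_one]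
  have := hpow n _ hc
  rwa [Function.comp_assoc, ← Equiv.Perm.coe_mul, hn, Equiv.Perm.coe_one, Function.comp_id] at this

/-- The number whose binary digits are those of `w`, permuted by `π`. -/
def permuteBits (π : Fin 24 → Fin 24) (w : ℕ) : ℕ :=
  (List.finRange 24).foldr (fun i u => 2 * u + (w.testBit (π i)).toNat) 0

lemma mem_golayAut_of_basis {π : Equiv.Perm (Fin 24)}
    (h : ∀ b ∈ golayBasis, bitVec b ∘ π = bitVec (permuteBits π b) ∧
      golayReduce (permuteBits π b) golayBasis = 0) : π ∈ golayAut := by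
  refine mem_golayAut_of_forall fun c hc => ?_
  rw [golayCode_eq_span_basis] at hc
  induction hc using Submodule.span_induction with
  | mem x hx =>
    obtain ⟨b, hb, rfl⟩ := hx
    rw [(h b hb).1]
    exact bitVec_mem_golayCode (h b hb).2
  | zero => exact golayCode.zero_mem
  | add x y _ _ hx hy => exact golayCode.add_mem hx hy
  | smul a x _ hx => exact golayCode.smul_mem a hx

/-- The permutation `x ↦ x + 1` of the projective line over the field with 23 elements. -/
def shiftPerm : Equiv.Perm (Fin 24) where
  toFun i := if i = 23 then 23 else Fin.ofNat 24 ((i.val + 1) % 23)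
  invFun i := if i = 23 then 23 else Fin.ofNat 24 ((i.val + 22) % 23)
  left_inv := by decide +kernel
  right_inv := by decide +kernel

/-- The permutation `x ↦ 2 x` of the projective line over the field with 23 elements. -/
def doublePerm : Equiv.Perm (Fin 24) where
  toFun i := if i = 23 then 23 else Fin.ofNat 24 ((i.val * 2) % 23)
  invFun i := if i = 23 then 23 else Fin.ofNat 24 ((i.val * 12) % 23)
  left_inv := by decide +kernel
  right_inv := by decide +kernel

/-- The permutation `x ↦ -1 / x` of the projective line over the field with 23 elements. -/
def inversionPerm : Equiv.Perm (Fin 24) where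
  toFun i := if i = 23 then 0 else if i = 0 then 23 else Fin.ofNat 24 (23 - i.val ^ 21 % 23)
  invFun i := if i = 23 then 0 else if i = 0 then 23 else Fin.ofNat 24 (23 - i.val ^ 21 % 23)
  left_inv := by decide +kernel
  right_inv := by decide +kernel

lemma shiftPerm_mem : shiftPerm ∈ golayAut := mem_golayAut_of_basis (by decide +kernel)
lemma doublePerm_mem : doublePerm ∈ golayAut := mem_golayAut_of_basis (by decide +kernel)
lemma inversionPerm_mem : inversionPerm ∈ golayAut := mem_golayAut_of_basis (by decide +kernel)

lemma exists_golayAut_apply_eq_infinity (a : Fin 24) : ∃ π ∈ golayAut, π a = 23 := by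
  have h : ∀ a : Fin 24, a = 23 ∨ ∃ n : Fin 23, inversionPerm ((shiftPerm ^ n.val) a) = 23 := by
    decide +kernel
  rcases h a with rfl | ⟨n, hn⟩
  · exact ⟨1, golayAut.one_mem, rfl⟩
  · exact ⟨inversionPerm * shiftPerm ^ n.val,
      golayAut.mul_mem inversionPerm_mem (golayAut.pow_mem shiftPerm_mem _), hn⟩

/-- Any three points can be moved to `∞, 0, 1`: after the first two have been moved to `∞` and
`0`, the third is a power of 2 or the negative of one, as the powers of 2 are the squares.
A multiplication makes it `±1`, and a shift by 1 takes `0, -1` to `1, 0`. -/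
lemma exists_golayAut_triple {a b c : Fin 24} (hab : a ≠ b) (hac : a ≠ c) (hbc : b ≠ c) :
    ∃ π ∈ golayAut, Finset.image π {a, b, c} = {23, 0, 1} := by
  obtain ⟨π, hπ, ha⟩ := exists_golayAut_apply_eq_infinity a
  have h0 : ∀ b : Fin 24, b ≠ 23 → ∃ n : Fin 23, (shiftPerm ^ n.val) b = 0 := by decide +kernel
  have hs : ∀ n : Fin 23, (shiftPerm ^ n.val) 23 = 23 := by decide +kernel
  have h1 : ∀ c : Fin 24, c ≠ 23 → c ≠ 0 → ∃ n : Fin 23, ∃ m ∈ ([0, 1] : List (Fin 23)),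
      (shiftPerm ^ m.val) ((doublePerm ^ n.val) 23) = 23 ∧
      (((shiftPerm ^ m.val) ((doublePerm ^ n.val) 0) = 0 ∧
        (shiftPerm ^ m.val) ((doublePerm ^ n.val) c) = 1) ∨
      ((shiftPerm ^ m.val) ((doublePerm ^ n.val) 0) = 1 ∧
        (shiftPerm ^ m.val) ((doublePerm ^ n.val) c) = 0)) := by
    decide +kernel
  obtain ⟨k, hb⟩ := h0 (π b) (by rw [← ha]; exact fun h => hab (π.injective h).symm)
  have ha' : (shiftPerm ^ k.val) (π a) = 23 := by rw [ha, hs]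
  obtain ⟨n, m, -, h23, h⟩ := h1 ((shiftPerm ^ k.val) (π c))
    (by rw [← ha']; simpa using hac.symm) (by rw [← hb]; simpa using hbc.symm)
  refine ⟨shiftPerm ^ m.val * (doublePerm ^ n.val * (shiftPerm ^ k.val * π)),
    golayAut.mul_mem (golayAut.pow_mem shiftPerm_mem _) (golayAut.mul_mem
      (golayAut.pow_mem doublePerm_mem _) (golayAut.mul_mem
        (golayAut.pow_mem shiftPerm_mem _) hπ)), ?_⟩
  rw [Finset.image_insert, Finset.image_insert, Finset.image_singleton]
  simp only [Equiv.Perm.mul_apply, ha', hb, h23]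
  rcases h with ⟨h, h'⟩ | ⟨h, h'⟩ <;> rw [h, h']
  rw [Finset.pair_comm]

/-! ### A sextet -/

/-- The index of the tetrad containing a point, for the sextet of the tetrad `{∞, 0, 1, 2}`, which
has index 0. -/
def sextet (i : Fin 24) : Fin 6 :=
  ([0, 0, 0, 2, 1, 2, 3, 3, 5, 4, 4, 5, 5, 1, 2, 4, 1, 2, 5, 3, 4, 3, 1, 0] : List (Fin 6)).getD i 0

lemma sum_sextet_zero {M : Type*} [AddCommMonoid M] (f : Fin 24 → M) :
    ∑ i with sextet i = 0, f i = f 0 + (f 1 + (f 2 + f 23)) := by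
  have h : Finset.univ.filter (fun i => sextet i = 0) = {0, 1, 2, 23} := by decide +kernel
  rw [h, Finset.sum_insert (by decide), Finset.sum_insert (by decide),
    Finset.sum_insert (by decide), Finset.sum_singleton]

lemma card_sextet (t : Fin 6) : (Finset.univ.filter fun i => sextet i = t).card = 4 := by
  revert t
  decide +kernel

/-- The indicator word of a tetrad of the sextet. -/
def tetrad (t : Fin 6) (i : Fin 24) : ZMod 2 := if sextet i = t then 1 else 0

lemma tetrad_add_mem (t : Fin 6) : tetrad 0 + tetrad t ∈ golayCode := by
  have h : ∀ t : Fin 6, ∃ w ∈ ([0, 12656663, 8536111, 11010247, 9471495, 8657159] : List ℕ),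
    tetrad 0 + tetrad t = bitVec w ∧ golayReduce w golayBasis = 0 := by decide +kernel
  obtain ⟨w, -, hw, hw'⟩ := h t
  rw [hw]
  exact bitVec_mem_golayCode hw'

/-- Every word of the code other than `0` and `1` is met in an odd number of points by some
translate of the tetrad `{∞, 0, 1, 2}`. -/
lemma exists_golayAut_tetrad_sum_eq_one {c : Fin 24 → ZMod 2} (hc : c ∈ golayCode) (h0 : c ≠ 0)
    (h1 : c ≠ 1) : ∃ π ∈ golayAut, ∑ i with sextet i = 0, c (π i) = 1 := by
  have key := forall_mem_golayWords (p := fun w => w.beq 0 || (w.beq (2 ^ 24 - 1) ||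
      (List.finRange 23).any fun s => w.testBit s.val ^^ (w.testBit ((s.val + 1) % 23) ^^
        (w.testBit ((s.val + 2) % 23) ^^ w.testBit 23)))) (by decide +kernel)
  obtain ⟨w, hw, rfl⟩ := (mem_golayCode_iff c).1 hc
  have := key w hw
  simp only [Bool.or_eq_true, Nat.beq_eq, List.any_eq_true] at this
  rcases this with rfl | rfl | ⟨s, -, hs⟩
  · exact absurd bitVec_zero h0
  · exact absurd (by decide) h1
  · refine ⟨shiftPerm ^ s.val, golayAut.pow_mem shiftPerm_mem _, ?_⟩
    have e : ∀ s : Fin 23, ((shiftPerm ^ s.val) 0).val = s.val ∧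
      ((shiftPerm ^ s.val) 1).val = (s.val + 1) % 23 ∧
      ((shiftPerm ^ s.val) 2).val = (s.val + 2) % 23 ∧ ((shiftPerm ^ s.val) 23).val = 23 := by
      decide +kernel
    obtain ⟨e0, e1, e2, e3⟩ := e s
    rw [sum_sextet_zero]
    simp only [bitVec, e0, e1, e2, e3]
    revert hs
    generalize w.testBit s.val = x
    generalize w.testBit ((s.val + 1) % 23) = y
    generalize w.testBit ((s.val + 2) % 23) = z
    generalize w.testBit 23 = u
    revert x y z u
    decide

/-! ### Integer coordinates for the Leech lattice -/

/-- An integer vector as a vector of Euclidean space. -/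
def intVec (x : Fin 24 → ℤ) : EuclideanSpace ℝ (Fin 24) := WithLp.toLp 2 fun i => (x i : ℝ)

@[simp] lemma intVec_apply (x : Fin 24 → ℤ) (i : Fin 24) : intVec x i = (x i : ℝ) := rfl

lemma intVec_injective : Function.Injective intVec := by
  intro x y h
  funext i
  have := congrArg (fun v : EuclideanSpace ℝ (Fin 24) => v i) h
  simpa using this

lemma intVec_add (x y : Fin 24 → ℤ) : intVec (x + y) = intVec x + intVec y := by
  ext i; simp

lemma intVec_sub (x y : Fin 24 → ℤ) : intVec (x - y) = intVec x - intVec y := by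
  ext i; simp

lemma intVec_neg (x : Fin 24 → ℤ) : intVec (-x) = -intVec x := by
  ext i; simp

lemma inner_intVec (x y : Fin 24 → ℤ) : ⟪intVec x, intVec y⟫ = ((x ⬝ᵥ y : ℤ) : ℝ) := by
  simp [PiLp.inner_apply, dotProduct, mul_comm]

/-- Reduction of an integer vector modulo 2. -/
def reduceTwo (k : Fin 24 → ℤ) : Fin 24 → ZMod 2 := fun i => (k i : ZMod 2)

/-- Membership in the Leech lattice for integer vectors. Given `x i = m + 2 * k i`, the congruence
`∑ i, x i ≡ 4 * m (mod 8)` reads `∑ i, k i ≡ 2 * m (mod 4)`. -/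
def IsLeech (x : Fin 24 → ℤ) : Prop :=
  ∃ (m : ℤ) (k : Fin 24 → ℤ), (∀ i, x i = m + 2 * k i) ∧ reduceTwo k ∈ golayCode ∧
    4 ∣ ∑ i, k i - 2 * m

lemma mem_leechLattice_iff {v : EuclideanSpace ℝ (Fin 24)} :
    v ∈ leechLattice ↔ ∃ x, IsLeech x ∧ intVec x = v := by
  constructor
  · rintro ⟨m, k, hv, hk, hm⟩
    refine ⟨fun i => m + 2 * k i, ⟨m, k, fun i => rfl, hk, ?_⟩, ?_⟩
    · have := hm.dvd
      simp only [Finset.sum_add_distrib, ← Finset.mul_sum, Finset.sum_const, Finset.card_univ,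
        Fintype.card_fin, nsmul_eq_mul, Nat.cast_ofNat] at this
      omega
    · ext i
      rw [hv i]
      rfl
  · rintro ⟨x, ⟨m, k, hx, hk, hm⟩, rfl⟩
    refine ⟨m, k, fun i => by rw [intVec_apply, hx i], hk, ?_⟩
    simp only [Finset.sum_add_distrib, ← Finset.mul_sum, Finset.sum_const, Finset.card_univ,
      Fintype.card_fin, nsmul_eq_mul, Nat.cast_ofNat]
    exact Int.modEq_iff_dvd.2 (by omega)

lemma intVec_mem_leechLattice {x : Fin 24 → ℤ} : intVec x ∈ leechLattice ↔ IsLeech x := by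
  rw [mem_leechLattice_iff]
  constructor
  · rintro ⟨y, hy, h⟩
    rwa [← intVec_injective h]
  · exact fun h => ⟨x, h, rfl⟩

lemma mem_leechShell_iff {n : ℕ} {v : EuclideanSpace ℝ (Fin 24)} :
    v ∈ leechShell n ↔ ∃ x, IsLeech x ∧ x ⬝ᵥ x = 16 * n ∧ intVec x = v := by
  constructor
  · rintro ⟨h, hn⟩
    obtain ⟨x, hx, rfl⟩ := mem_leechLattice_iff.1 h
    rw [inner_intVec] at hn
    exact ⟨x, hx, by exact_mod_cast hn, rfl⟩
  · rintro ⟨x, hx, hn, rfl⟩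
    refine ⟨intVec_mem_leechLattice.2 hx, ?_⟩
    rw [inner_intVec, hn]
    push_cast
    rfl

/-! ### Norms and inner products in the Leech lattice -/

lemma two_dvd_dotProduct {k l : Fin 24 → ℤ} (hk : reduceTwo k ∈ golayCode)
    (hl : reduceTwo l ∈ golayCode) : 2 ∣ k ⬝ᵥ l := by
  have := golayCode_dot hk hl
  rw [← Nat.cast_two, ← ZMod.intCast_zmod_eq_zero_iff_dvd]
  simpa [dotProduct, reduceTwo] using this

/-- The square of an integer is congruent modulo 4 to its parity. -/
lemma four_dvd_sq_sub_val (a : ℤ) : (4 : ℤ) ∣ a * a - ((a : ZMod 2).val : ℤ) := by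
  rw [ZMod.val_intCast]
  rcases Int.even_or_odd' a with ⟨b, rfl | rfl⟩
  · have h : (2 * b) % ((2 : ℕ) : ℤ) = 0 := by simp
    rw [h]
    exact ⟨b * b, by ring⟩
  · have h : (2 * b + 1) % ((2 : ℕ) : ℤ) = 1 := by push_cast; omega
    rw [h]
    exact ⟨b * b + b, by ring⟩

lemma val_le_sq (a : ℤ) : ((a : ZMod 2).val : ℤ) ≤ a * a := by
  rw [ZMod.val_intCast]
  rcases eq_or_ne a 0 with rfl | h
  · simp
  · have h1 : 0 < a * a := mul_self_pos.2 h
    have h2 : a % ((2 : ℕ) : ℤ) < 2 := Int.emod_lt_of_pos _ (by norm_num)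
    omega

lemma four_dvd_dotProduct_self_sub_weight (k : Fin 24 → ℤ) :
    (4 : ℤ) ∣ k ⬝ᵥ k - weight (reduceTwo k) := by
  rw [dotProduct, weight, Nat.cast_sum, ← Finset.sum_sub_distrib]
  exact Finset.dvd_sum fun i _ => four_dvd_sq_sub_val (k i)

lemma weight_le_dotProduct_self (k : Fin 24 → ℤ) : (weight (reduceTwo k) : ℤ) ≤ k ⬝ᵥ k := by
  rw [dotProduct, weight, Nat.cast_sum]
  exact Finset.sum_le_sum fun i _ => val_le_sq (k i)

lemma four_dvd_dotProduct_self {k : Fin 24 → ℤ} (hk : reduceTwo k ∈ golayCode) :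
    4 ∣ k ⬝ᵥ k := by
  have h1 := four_dvd_dotProduct_self_sub_weight k
  have h2 := weight_golayCode hk
  simp only [List.mem_cons, List.not_mem_nil, or_false] at h2
  omega

lemma dotProduct_affine (m n : ℤ) (k l : Fin 24 → ℤ) :
    (fun i => m + 2 * k i) ⬝ᵥ (fun i => n + 2 * l i) =
      24 * m * n + 2 * m * ∑ i, l i + 2 * n * ∑ i, k i + 4 * (k ⬝ᵥ l) := by
  have : ∀ i, (m + 2 * k i) * (n + 2 * l i) =
      m * n + 2 * m * l i + 2 * n * k i + 4 * (k i * l i) := fun i => by ring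
  simp only [dotProduct, this, Finset.sum_add_distrib, ← Finset.mul_sum, Finset.sum_const,
    Finset.card_univ, Fintype.card_fin, nsmul_eq_mul, Nat.cast_ofNat]
  ring

lemma IsLeech.eight_dvd_dotProduct {x y : Fin 24 → ℤ} (hx : IsLeech x) (hy : IsLeech y) :
    8 ∣ x ⬝ᵥ y := by
  obtain ⟨m, k, hx, hk, a, ha⟩ := hx
  obtain ⟨n, l, hy, hl, b, hb⟩ := hy
  obtain ⟨d, hd⟩ := two_dvd_dotProduct hk hl
  rw [funext hx, funext hy, dotProduct_affine, hd, eq_add_of_sub_eq ha, eq_add_of_sub_eq hb]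
  exact ⟨4 * m * n + m * b + n * a + d, by ring⟩

lemma IsLeech.sixteen_dvd_dotProduct_self {x : Fin 24 → ℤ} (hx : IsLeech x) : 16 ∣ x ⬝ᵥ x := by
  obtain ⟨m, k, hx, hk, a, ha⟩ := hx
  obtain ⟨d, hd⟩ := four_dvd_dotProduct_self hk
  rw [funext hx, dotProduct_affine, hd, eq_add_of_sub_eq ha]
  exact ⟨2 * m * m + m * a + d, by ring⟩

lemma reduceTwo_add_const_mem {k : Fin 24 → ℤ} (hk : reduceTwo k ∈ golayCode) (a : ℤ) :
    reduceTwo (fun i => k i + a) ∈ golayCode := by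
  have : reduceTwo (fun i => k i + a) = reduceTwo k + (a : ZMod 2) • 1 := by
    funext i; simp [reduceTwo]
  rw [this]
  exact golayCode.add_mem hk (golayCode.smul_mem _ ones_mem_golayCode)

/-- The integer `m` in the definition of the Leech lattice can be taken to be 0 or 1. -/
lemma IsLeech.normal_form {x : Fin 24 → ℤ} (hx : IsLeech x) :
    ∃ (m : ℤ) (k : Fin 24 → ℤ), (m = 0 ∨ m = 1) ∧ (∀ i, x i = m + 2 * k i) ∧
      reduceTwo k ∈ golayCode ∧ 4 ∣ ∑ i, k i - 2 * m := by
  obtain ⟨m, k, hx, hk, hm⟩ := hx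
  refine ⟨m % 2, fun i => k i + m / 2, by omega, fun i => ?_, reduceTwo_add_const_mem hk _, ?_⟩
  · rw [hx i]
    dsimp only
    omega
  · rw [Finset.sum_add_distrib]
    simp only [Finset.sum_const, Finset.card_univ, Fintype.card_fin, nsmul_eq_mul,
      Nat.cast_ofNat]
    omega

lemma two_dvd_dotProduct_self_sub_sum (l : Fin 24 → ℤ) : 2 ∣ l ⬝ᵥ l - ∑ i, l i := by
  rw [dotProduct, ← Finset.sum_sub_distrib]
  refine Finset.dvd_sum fun i _ => ?_
  have := Int.even_mul_pred_self (l i)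
  rw [show l i * l i - l i = l i * (l i - 1) by ring]
  exact this.two_dvd

lemma exists_eq_two_mul {k : Fin 24 → ℤ} (h : reduceTwo k = 0) :
    ∃ l : Fin 24 → ℤ, k = fun i => 2 * l i := by
  have : ∀ i, ∃ a, k i = 2 * a := fun i =>
    (ZMod.intCast_zmod_eq_zero_iff_dvd (k i) 2).1 (congrFun h i)
  choose l hl using this
  exact ⟨l, funext hl⟩

lemma dotProduct_two_mul (k : Fin 24 → ℤ) :
    (fun i => 2 * k i) ⬝ᵥ (fun i => 2 * k i) = 4 * (k ⬝ᵥ k) := by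
  simp only [dotProduct, Finset.mul_sum]
  exact Finset.sum_congr rfl fun i _ => by ring

lemma sum_two_mul (k : Fin 24 → ℤ) : ∑ i, 2 * k i = 2 * ∑ i, k i := by
  rw [Finset.mul_sum]

/-- A vector of the Leech lattice with odd coordinates has norm at least 24. -/
lemma le_dotProduct_self_of_odd (k : Fin 24 → ℤ) :
    24 ≤ (fun i => 1 + 2 * k i) ⬝ᵥ (fun i => 1 + 2 * k i) := by
  have h : ∑ _i : Fin 24, (1 : ℤ) ≤ (fun i => 1 + 2 * k i) ⬝ᵥ (fun i => 1 + 2 * k i) := by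
    refine Finset.sum_le_sum fun i _ => ?_
    have : 0 ≤ k i * (k i + 1) := by
      rcases le_or_gt 0 (k i) with h | h
      · positivity
      · exact mul_nonneg_of_nonpos_of_nonpos h.le (by omega)
    nlinarith
  simpa using h

/-- If the word of an even vector of the Leech lattice vanishes, then the norm of its half is
a multiple of 8. -/
lemma eight_dvd_of_reduceTwo_eq_zero {k : Fin 24 → ℤ} (h : reduceTwo k = 0)
    (hs : 4 ∣ ∑ i, k i) : 8 ∣ k ⬝ᵥ k := by
  obtain ⟨l, rfl⟩ := exists_eq_two_mul h
  rw [dotProduct_two_mul]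
  rw [sum_two_mul] at hs
  have := two_dvd_dotProduct_self_sub_sum l
  omega

lemma IsLeech.dotProduct_self_ne_sixteen {x : Fin 24 → ℤ} (hx : IsLeech x) : x ⬝ᵥ x ≠ 16 := by
  obtain ⟨m, k, rfl | rfl, hx, hk, hm⟩ := hx.normal_form
  · simp only [zero_add, mul_zero, sub_zero] at hx hm
    rw [funext hx, dotProduct_two_mul]
    intro h16
    have h1 := weight_le_dotProduct_self k
    have h2 := weight_golayCode hk
    simp only [List.mem_cons, List.not_mem_nil, or_false] at h2
    have h3 := eight_dvd_of_reduceTwo_eq_zero (weight_eq_zero (c := reduceTwo k) (by omega)) hm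
    omega
  · have := le_dotProduct_self_of_odd k
    rw [funext hx]
    omega

/-- The minimal norm of the Leech lattice is 32. -/
lemma IsLeech.le_dotProduct_self {x : Fin 24 → ℤ} (hx : IsLeech x) (h0 : x ≠ 0) :
    32 ≤ x ⬝ᵥ x := by
  have h1 : x ⬝ᵥ x ≠ 0 := fun h => h0 (dotProduct_self_eq_zero.1 h)
  have h2 : 0 ≤ x ⬝ᵥ x := Finset.sum_nonneg fun i _ => mul_self_nonneg _
  have h3 := hx.sixteen_dvd_dotProduct_self
  have h4 := hx.dotProduct_self_ne_sixteen
  omega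

lemma IsLeech.add {x y : Fin 24 → ℤ} (hx : IsLeech x) (hy : IsLeech y) : IsLeech (x + y) := by
  rw [← intVec_mem_leechLattice, intVec_add]
  exact leechLattice.add_mem (intVec_mem_leechLattice.2 hx) (intVec_mem_leechLattice.2 hy)

lemma IsLeech.sub {x y : Fin 24 → ℤ} (hx : IsLeech x) (hy : IsLeech y) : IsLeech (x - y) := by
  rw [← intVec_mem_leechLattice, intVec_sub]
  exact leechLattice.sub_mem (intVec_mem_leechLattice.2 hx) (intVec_mem_leechLattice.2 hy)

/-! ### Automorphisms of the Leech lattice: permutations and sign changes -/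

/-- Two vectors are equivalent if an isometry that preserves the Leech lattice maps one to the
other. -/
def LeechEquiv (v w : EuclideanSpace ℝ (Fin 24)) : Prop :=
  ∃ g : EuclideanSpace ℝ (Fin 24) ≃ₗᵢ[ℝ] EuclideanSpace ℝ (Fin 24),
    (∀ x, g x ∈ leechLattice ↔ x ∈ leechLattice) ∧ g v = w

lemma LeechEquiv.symm {v w : EuclideanSpace ℝ (Fin 24)} (h : LeechEquiv v w) : LeechEquiv w v := by
  obtain ⟨g, hg, rfl⟩ := h
  exact ⟨g.symm, fun x => by rw [← hg (g.symm x), g.apply_symm_apply], g.symm_apply_apply v⟩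

lemma LeechEquiv.trans {u v w : EuclideanSpace ℝ (Fin 24)} (h : LeechEquiv u v)
    (h' : LeechEquiv v w) : LeechEquiv u w := by
  obtain ⟨g, hg, rfl⟩ := h
  obtain ⟨f, hf, rfl⟩ := h'
  exact ⟨g.trans f, fun x => by rw [LinearIsometryEquiv.trans_apply, hf, hg], rfl⟩

/-- The involution `f` is described on the lattice by a map `F` of integer vectors. Isometric
involutions that map the lattice into itself are automorphisms of the lattice. -/
lemma LeechEquiv.of_involutive
    (f : EuclideanSpace ℝ (Fin 24) →ₗ[ℝ] EuclideanSpace ℝ (Fin 24)) (hf : Function.Involutive f)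
    (hn : ∀ x, ‖f x‖ = ‖x‖) (F : (Fin 24 → ℤ) → Fin 24 → ℤ)
    (hF : ∀ x, IsLeech x → f (intVec x) = intVec (F x) ∧ IsLeech (F x)) {x : Fin 24 → ℤ}
    (hx : IsLeech x) : LeechEquiv (intVec x) (intVec (F x)) := by
  have hmem : ∀ v ∈ leechLattice, f v ∈ leechLattice := by
    intro v hv
    obtain ⟨y, hy, rfl⟩ := mem_leechLattice_iff.1 hv
    rw [(hF y hy).1]
    exact intVec_mem_leechLattice.2 (hF y hy).2
  refine ⟨⟨LinearEquiv.ofInvolutive f hf, hn⟩, fun v => ⟨fun h => ?_, hmem v⟩, (hF x hx).1⟩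
  rw [← hf v]
  exact hmem _ h

lemma IsLeech.comp_perm {x : Fin 24 → ℤ} (hx : IsLeech x) {π : Equiv.Perm (Fin 24)}
    (hπ : π ∈ golayAut) : IsLeech (x ∘ π) := by
  obtain ⟨m, k, hx, hk, hm⟩ := hx
  refine ⟨m, k ∘ π, fun i => hx (π i), (hπ _).2 hk, ?_⟩
  simp only [Function.comp_apply]
  rwa [Equiv.sum_comp π k]

lemma LeechEquiv.comp_perm (x : Fin 24 → ℤ) {π : Equiv.Perm (Fin 24)} (hπ : π ∈ golayAut) :
    LeechEquiv (intVec x) (intVec (x ∘ π)) := by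
  have hg : ∀ y : Fin 24 → ℤ, LinearIsometryEquiv.piLpCongrLeft 2 ℝ ℝ π⁻¹ (intVec y) =
      intVec (y ∘ π) := by
    intro y
    ext i
    simp [LinearIsometryEquiv.piLpCongrLeft_apply, Equiv.piCongrLeft', Equiv.Perm.inv_def]
  refine ⟨LinearIsometryEquiv.piLpCongrLeft 2 ℝ ℝ π⁻¹, fun v => ⟨fun h => ?_, fun h => ?_⟩, hg x⟩
  · obtain ⟨y, hy, hyv⟩ := mem_leechLattice_iff.1 h
    refine mem_leechLattice_iff.2 ⟨y ∘ ⇑π⁻¹, hy.comp_perm (golayAut.inv_mem hπ), ?_⟩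
    apply (LinearIsometryEquiv.piLpCongrLeft 2 ℝ ℝ π⁻¹).injective
    rw [hg, ← hyv, Function.comp_assoc, ← Equiv.Perm.coe_mul, inv_mul_cancel, Equiv.Perm.coe_one,
      Function.comp_id]
  · obtain ⟨y, hy, rfl⟩ := mem_leechLattice_iff.1 h
    rw [hg]
    exact intVec_mem_leechLattice.2 (hy.comp_perm hπ)

/-- The change of the signs of the coordinates in a word. -/
def signChange (c : Fin 24 → ZMod 2) (x : Fin 24 → ℤ) : Fin 24 → ℤ :=
  fun i => if c i = 1 then -x i else x i

lemma IsLeech.signChange {c : Fin 24 → ZMod 2} (hc : c ∈ golayCode) {x : Fin 24 → ℤ}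
    (hx : IsLeech x) : IsLeech (signChange c x) := by
  obtain ⟨m, k, hx, hk, hm⟩ := hx
  let d : Fin 24 → ℤ := fun i => if c i = 1 then 1 else 0
  have hdc : ∀ i, ((d i : ℤ) : ZMod 2) = c i := by
    intro i
    simp only [d]
    generalize c i = a
    revert a
    decide
  have hd : reduceTwo d ∈ golayCode := by
    rwa [show reduceTwo d = c from funext hdc]
  have hdd : d ⬝ᵥ d = ∑ i, d i := Finset.sum_congr rfl fun i _ => by
    simp only [d]
    split_ifs <;> rfl
  refine ⟨m, fun i => k i - d i * (m + 2 * k i), fun i => ?_, ?_, ?_⟩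
  · simp only [_root_.signChange, hx, d]
    split_ifs <;> ring
  · have : reduceTwo (fun i => k i - d i * (m + 2 * k i)) = reduceTwo k + (m : ZMod 2) • c := by
      funext i
      have h2 : (2 : ZMod 2) = 0 := rfl
      have hneg : ∀ a b : ZMod 2, a - b = a + b := by decide
      simp only [reduceTwo, Int.cast_sub, Int.cast_mul, Int.cast_add, Int.cast_ofNat, h2, hdc,
        zero_mul, add_zero, Pi.add_apply, Pi.smul_apply, smul_eq_mul, hneg]
      ring
    rw [this]
    exact golayCode.add_mem hk (golayCode.smul_mem _ hc)
  · have h1 : ∑ i, (k i - d i * (m + 2 * k i)) = ∑ i, k i - m * ∑ i, d i - 2 * (d ⬝ᵥ k) := by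
      rw [dotProduct, Finset.mul_sum, Finset.mul_sum, ← Finset.sum_sub_distrib,
        ← Finset.sum_sub_distrib]
      exact Finset.sum_congr rfl fun i _ => by ring
    obtain ⟨a, ha⟩ := four_dvd_dotProduct_self hd
    obtain ⟨b, hb⟩ := two_dvd_dotProduct hd hk
    obtain ⟨e, he⟩ := hm
    rw [h1, ← hdd, ha, hb]
    exact ⟨e - m * a - b, by linear_combination he⟩

lemma LeechEquiv.signChange {c : Fin 24 → ZMod 2} (hc : c ∈ golayCode) {x : Fin 24 → ℤ}
    (hx : IsLeech x) : LeechEquiv (intVec x) (intVec (signChange c x)) := by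
  let f : EuclideanSpace ℝ (Fin 24) →ₗ[ℝ] EuclideanSpace ℝ (Fin 24) :=
    { toFun := fun x => WithLp.toLp 2 fun i => if c i = 1 then -x i else x i
      map_add' := fun x y => by
        ext i
        simp only [PiLp.add_apply]
        split_ifs <;> ring
      map_smul' := fun a x => by
        ext i
        simp only [PiLp.smul_apply, smul_eq_mul, RingHom.id_apply]
        split_ifs <;> ring }
  have hf : ∀ x i, f x i = if c i = 1 then -x i else x i := fun _ _ => rfl
  refine LeechEquiv.of_involutive f (fun x => ?_) (fun x => ?_) (_root_.signChange c)
    (fun x hx => ⟨?_, hx.signChange hc⟩) hx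
  · ext i
    rw [hf, hf]
    split_ifs <;> simp
  · rw [EuclideanSpace.norm_eq, EuclideanSpace.norm_eq]
    congr 1
    refine Finset.sum_congr rfl fun i _ => ?_
    rw [hf]
    split_ifs <;> simp
  · ext i
    rw [hf]
    simp only [intVec_apply, _root_.signChange]
    split_ifs <;> simp

/-! ### The automorphism of the Leech lattice attached to a sextet -/

/-- The sum of the coordinates in a tetrad. -/
def tetradSum {R : Type*} [AddCommMonoid R] (x : Fin 24 → R) (t : Fin 6) : R :=
  ∑ i with sextet i = t, x i

lemma sum_mul_sextet {R : Type*} [CommSemiring R] (x : Fin 24 → R) (a : Fin 6 → R) :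
    ∑ i, a (sextet i) * x i = ∑ t, a t * tetradSum x t := by
  rw [← Finset.sum_fiberwise _ sextet]
  refine Finset.sum_congr rfl fun t _ => ?_
  rw [tetradSum, Finset.mul_sum]
  refine Finset.sum_congr rfl fun i hi => ?_
  rw [(Finset.mem_filter.1 hi).2]

lemma tetradSum_one {R : Type*} [CommSemiring R] (t : Fin 6) :
    tetradSum (fun _ => (1 : R)) t = 4 := by
  rw [tetradSum, Finset.sum_const, card_sextet]
  simp

lemma sum_sextet {R : Type*} [CommSemiring R] (a : Fin 6 → R) :
    ∑ i, a (sextet i) = 4 * ∑ t, a t := by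
  have := sum_mul_sextet (fun _ => (1 : R)) a
  simp only [mul_one, tetradSum_one] at this
  rw [this, Finset.mul_sum]
  exact Finset.sum_congr rfl fun t _ => mul_comm _ _

/-- The reflection of every tetrad block in its all-ones vector, followed by the change of the signs
on tetrad 0. The integer division is exact on the Leech lattice, where tetrad sums are even. -/
def sextetMap (x : Fin 24 → ℤ) : Fin 24 → ℤ := fun i =>
  if sextet i = 0 then tetradSum x 0 / 2 - x i else x i - tetradSum x (sextet i) / 2

/-- All tetrads of the sextet meet a word of the code in the same parity. -/
lemma even_tetradSum_add {k : Fin 24 → ℤ} (hk : reduceTwo k ∈ golayCode) (t : Fin 6) :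
    2 ∣ tetradSum k t + tetradSum k 0 := by
  have h := golayCode_dot (tetrad_add_mem t) hk
  rw [← Nat.cast_two, ← ZMod.intCast_zmod_eq_zero_iff_dvd, ← h]
  simp only [Pi.add_apply, add_mul, Finset.sum_add_distrib, tetradSum, tetrad, reduceTwo, ite_mul,
    one_mul, zero_mul, Finset.sum_ite, Finset.sum_const_zero, add_zero]
  push_cast
  ring

lemma tetradSum_affine (m : ℤ) (k : Fin 24 → ℤ) (t : Fin 6) :
    tetradSum (fun i => m + 2 * k i) t = 2 * (2 * m + tetradSum k t) := by
  simp only [tetradSum, Finset.sum_add_distrib, Finset.sum_const, card_sextet, nsmul_eq_mul,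
    ← Finset.mul_sum]
  push_cast
  ring

lemma IsLeech.two_dvd_tetradSum {x : Fin 24 → ℤ} (hx : IsLeech x) (t : Fin 6) :
    2 ∣ tetradSum x t := by
  obtain ⟨m, k, hx, -, -⟩ := hx
  rw [funext hx, tetradSum_affine]
  exact ⟨_, rfl⟩

/-- For `x i = m + 2 * k i` and `κ` the tetrad sums of `k`, the image is `m' + 2 * k'` with
`m' = m + κ 0`, where `k' = -k` on tetrad 0 and `k' = k - m - (κ t + κ 0) / 2` on tetrad `t`. So the
word changes by a sum of tetrads, and the number of tetrads in it is even because of the congruence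
`∑ i, k i ≡ 2 * m (mod 4)`. -/
lemma IsLeech.sextetMap {x : Fin 24 → ℤ} (hx : IsLeech x) : IsLeech (sextetMap x) := by
  obtain ⟨m, k, hx, hk, hm⟩ := hx
  choose h hh using even_tetradSum_add hk
  have hS : ∀ t, tetradSum x t / 2 = 2 * m + tetradSum k t := fun t => by
    rw [funext hx, tetradSum_affine]
    omega
  have hsum : ∑ i, k i = ∑ t, tetradSum k t := by
    simpa using sum_mul_sextet k (fun _ => (1 : ℤ))
  refine ⟨m + tetradSum k 0, fun i =>
    (if sextet i = 0 then -1 else 1) * k i + (if sextet i = 0 then 0 else -(m + h (sextet i))),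
    fun i => ?_, ?_, ?_⟩
  · simp only [_root_.sextetMap, hS, hx]
    have := hh (sextet i)
    split_ifs with h0
    · ring
    · linarith
  · -- The tetrads with `a t = 1` are added to the word.
    let a : Fin 6 → ZMod 2 := fun t => if t = 0 then 0 else ((m + h t : ℤ) : ZMod 2)
    have ha : ∑ t, a t = 0 := by
      have : ∑ t, a t =
          (((m + h 1) + (m + h 2) + (m + h 3) + (m + h 4) + (m + h 5) : ℤ) : ZMod 2) := by
        rw [Fin.sum_univ_six]
        simp [a]
      rw [this]
      refine (ZMod.intCast_zmod_eq_zero_iff_dvd _ 2).2 ?_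
      rw [Fin.sum_univ_six] at hsum
      have h1 := hh 1
      have h2 := hh 2
      have h3 := hh 3
      have h4 := hh 4
      have h5 := hh 5
      push_cast
      omega
    have key : reduceTwo (fun i => (if sextet i = 0 then -1 else 1) * k i +
        (if sextet i = 0 then 0 else -(m + h (sextet i)))) =
        reduceTwo k + ∑ t, a t • (tetrad 0 + tetrad t) := by
      funext i
      have h1 : (∑ t, a t • (tetrad 0 + tetrad t)) i = a (sextet i) := by
        simp only [smul_add, Finset.sum_add_distrib, ← Finset.sum_smul, ha, zero_smul, zero_add]
        simp only [Finset.sum_apply, Pi.smul_apply, smul_eq_mul, tetrad, mul_ite, mul_one, mul_zero,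
          Finset.sum_ite_eq, Finset.mem_univ, if_true]
      have hneg : ∀ b : ZMod 2, -b = b := by decide
      rw [Pi.add_apply, h1]
      simp only [reduceTwo, a]
      split_ifs <;> simp [hneg, add_comm]
    rw [key]
    exact golayCode.add_mem hk
      (golayCode.sum_mem fun t _ => golayCode.smul_mem _ (tetrad_add_mem t))
  · have e1 := sum_mul_sextet k (fun t => if t = 0 then -1 else 1)
    have e2 := sum_sextet (fun t => if t = 0 then 0 else -(m + h t))
    rw [Finset.sum_add_distrib, e1, e2]
    rw [Fin.sum_univ_six] at hsum ⊢
    rw [Fin.sum_univ_six]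
    have h1 := hh 1
    have h2 := hh 2
    have h3 := hh 3
    have h4 := hh 4
    have h5 := hh 5
    simp only [Fin.isValue, Fin.reduceEq, if_false, if_true]
    omega

lemma LeechEquiv.sextetMap {x : Fin 24 → ℤ} (hx : IsLeech x) :
    LeechEquiv (intVec x) (intVec (sextetMap x)) := by
  let ε : Fin 6 → ℝ := fun t => if t = 0 then -1 else 1
  have hε : ∀ t, ε t * ε t = 1 := fun t => by simp only [ε]; split_ifs <;> norm_num
  let f : EuclideanSpace ℝ (Fin 24) →ₗ[ℝ] EuclideanSpace ℝ (Fin 24) :=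
    { toFun := fun x => WithLp.toLp 2 fun i =>
        ε (sextet i) * (x i - tetradSum x.ofLp (sextet i) / 2)
      map_add' := fun x y => by
        ext i
        simp only [PiLp.add_apply, tetradSum, Finset.sum_add_distrib]
        ring
      map_smul' := fun a x => by
        ext i
        simp only [PiLp.smul_apply, smul_eq_mul, RingHom.id_apply, tetradSum, ← Finset.mul_sum]
        ring }
  have hf : ∀ x i, f x i = ε (sextet i) * (x i - tetradSum x.ofLp (sextet i) / 2) := fun _ _ => rfl
  have hft : ∀ x t, tetradSum (f x).ofLp t = -ε t * tetradSum x.ofLp t := by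
    intro x t
    have : tetradSum (f x).ofLp t =
        ∑ i with sextet i = t, ε t * (x i - tetradSum x.ofLp t / 2) := by
      refine Finset.sum_congr rfl fun i hi => ?_
      rw [hf, (Finset.mem_filter.1 hi).2]
    rw [this, ← Finset.mul_sum, Finset.sum_sub_distrib, Finset.sum_const, card_sextet, tetradSum]
    simp only [nsmul_eq_mul, Nat.cast_ofNat]
    ring
  refine LeechEquiv.of_involutive f (fun x => ?_) (fun x => ?_) _root_.sextetMap
    (fun x hx => ⟨?_, hx.sextetMap⟩) hx
  · ext i
    rw [hf, hft, hf]
    linear_combination x i * hε (sextet i)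
  · rw [EuclideanSpace.norm_eq, EuclideanSpace.norm_eq]
    congr 1
    simp only [Real.norm_eq_abs, sq_abs]
    have e1 := sum_mul_sextet x.ofLp (fun t => tetradSum x.ofLp t)
    have e2 := sum_sextet (fun t => tetradSum x.ofLp t * tetradSum x.ofLp t)
    have e3 : ∀ i, f x i ^ 2 = x i ^ 2 - tetradSum x.ofLp (sextet i) * x i +
        tetradSum x.ofLp (sextet i) * tetradSum x.ofLp (sextet i) / 4 := by
      intro i
      rw [hf]
      linear_combination (x i - tetradSum x.ofLp (sextet i) / 2) ^ 2 * hε (sextet i)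
    simp only [e3, Finset.sum_add_distrib, Finset.sum_sub_distrib, ← Finset.sum_div]
    rw [e1, e2]
    ring
  · ext i
    have ht : ∀ t, tetradSum (intVec x).ofLp t / 2 = ((tetradSum x t / 2 : ℤ) : ℝ) := by
      intro t
      have h2 : tetradSum (intVec x).ofLp t = ((tetradSum x t : ℤ) : ℝ) := by
        simp [tetradSum]
      obtain ⟨b, hb⟩ := hx.two_dvd_tetradSum t
      rw [h2, hb, Int.mul_ediv_cancel_left _ (by norm_num)]
      push_cast
      ring
    rw [hf, ht]
    simp only [intVec_apply, _root_.sextetMap, ε]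
    split_ifs with h0
    · rw [h0]
      push_cast
      ring
    · push_cast
      ring

/-! ### Transitivity on the vectors of shell 3 -/

lemma LeechEquiv.dotProduct_self {x y : Fin 24 → ℤ} (h : LeechEquiv (intVec x) (intVec y)) :
    y ⬝ᵥ y = x ⬝ᵥ x := by
  obtain ⟨g, -, hg⟩ := h
  have := g.inner_map_map (intVec x) (intVec x)
  rw [hg, inner_intVec, inner_intVec] at this
  exact_mod_cast this

lemma LeechEquiv.isLeech {x y : Fin 24 → ℤ} (h : LeechEquiv (intVec x) (intVec y))
    (hx : IsLeech x) : IsLeech y := by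
  obtain ⟨g, hg, hgx⟩ := h
  rw [← intVec_mem_leechLattice, ← hgx, hg]
  exact intVec_mem_leechLattice.2 hx

/-- If the coordinates of `x` are even, a permutation moves its word to one that meets tetrad 0 in
an odd number of points; then half the sum over this tetrad is odd, and the sextet map subtracts it
from even coordinates. -/
lemma exists_leechEquiv_odd {x : Fin 24 → ℤ} (hx : IsLeech x) (h48 : x ⬝ᵥ x = 48) :
    ∃ k : Fin 24 → ℤ, reduceTwo k ∈ golayCode ∧
      LeechEquiv (intVec x) (intVec fun i => 1 + 2 * k i) := by
  obtain ⟨m, k, rfl | rfl, hxk, hk, hm⟩ := hx.normal_form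
  · simp only [zero_add, mul_zero, sub_zero] at hxk hm
    rw [funext hxk, dotProduct_two_mul] at h48
    have h0 : reduceTwo k ≠ 0 := fun h => by
      have := eight_dvd_of_reduceTwo_eq_zero h hm
      omega
    have h1 : reduceTwo k ≠ 1 := fun h => by
      have h2 := weight_le_dotProduct_self k
      have h3 : weight 1 = 24 := by decide +kernel
      rw [h, h3] at h2
      omega
    obtain ⟨π, hπ, hodd⟩ := exists_golayAut_tetrad_sum_eq_one hk h0 h1
    have he := (LeechEquiv.comp_perm x hπ).trans (LeechEquiv.sextetMap (hx.comp_perm hπ))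
    obtain ⟨m, l, rfl | rfl, hl, hlC, -⟩ := (he.isLeech hx).normal_form
    · exfalso
      have h2 := hl 0
      have h3 : tetradSum (x ∘ π) 0 = 2 * tetradSum (k ∘ π) 0 := by
        simp only [tetradSum, Function.comp_apply, hxk, Finset.mul_sum]
      have h4 : ((tetradSum (k ∘ π) 0 : ℤ) : ZMod 2) = 1 := by
        rw [← hodd, tetradSum]
        push_cast
        rfl
      rw [sextetMap, if_pos (by decide), h3, Function.comp_apply, hxk] at h2
      have h5 : ¬ ((2 : ℕ) : ℤ) ∣ tetradSum (k ∘ π) 0 := fun h => by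
        rw [(ZMod.intCast_zmod_eq_zero_iff_dvd _ 2).2 h] at h4
        exact zero_ne_one h4
      omega
    · exact ⟨l, hlC, by rwa [← funext hl]⟩
  · refine ⟨k, hk, ?_⟩
    rw [← funext hxk]
    exact ⟨LinearIsometryEquiv.refl ℝ _, fun _ => Iff.rfl, rfl⟩

/-- The coordinates that are 3 modulo 4 form a word of the code, on which the signs are changed. -/
lemma exists_leechEquiv_one_mod_four {x : Fin 24 → ℤ} (hx : IsLeech x) (h48 : x ⬝ᵥ x = 48) :
    ∃ j : Fin 24 → ℤ, LeechEquiv (intVec x) (intVec fun i => 1 + 4 * j i) := by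
  obtain ⟨k, hk, he⟩ := exists_leechEquiv_odd hx h48
  have he' := he.trans (LeechEquiv.signChange hk (he.isLeech hx))
  have : ∀ i, ∃ a, signChange (reduceTwo k) (fun i => 1 + 2 * k i) i = 1 + 4 * a := by
    intro i
    simp only [signChange]
    split_ifs with h <;> rw [reduceTwo] at h
    · have : ¬ ((2 : ℕ) : ℤ) ∣ k i := fun h2 => by
        rw [(ZMod.intCast_zmod_eq_zero_iff_dvd _ 2).2 h2] at h
        exact zero_ne_one h
      exact ⟨-((k i + 1) / 2), by push_cast at this; omega⟩
    · have : ((2 : ℕ) : ℤ) ∣ k i := by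
        rw [← ZMod.intCast_zmod_eq_zero_iff_dvd]
        generalize (k i : ZMod 2) = a at h
        revert a
        decide
      exact ⟨k i / 2, by push_cast at this; omega⟩
  choose j hj using this
  exact ⟨j, by rwa [← funext hj]⟩

/-- The vectors of shell 3 all of whose coordinates are 1 modulo 4 are those of the shapes
`(5, 1²³)` and `(-3³, 1²¹)`. -/
lemma shape_of_one_mod_four {j : Fin 24 → ℤ}
    (h : (fun i => 1 + 4 * j i) ⬝ᵥ (fun i => 1 + 4 * j i) = 48) :
    (∃ a, j = fun i => if i = a then 1 else 0) ∨
      ∃ S : Finset (Fin 24), S.card = 3 ∧ j = fun i => if i ∈ S then -1 else 0 := by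
  -- The summands take the values 0, 1, 3 at `j i = 0, -1, 1`, and larger ones elsewhere.
  have hsum : ∑ i, (2 * (j i * j i) + j i) = 3 := by
    have : (fun i => 1 + 4 * j i) ⬝ᵥ (fun i => 1 + 4 * j i) =
        24 + 8 * ∑ i, (2 * (j i * j i) + j i) := by
      have h24 : (24 : ℤ) = ∑ _i : Fin 24, 1 := by simp
      rw [dotProduct, Finset.mul_sum, h24, ← Finset.sum_add_distrib]
      exact Finset.sum_congr rfl fun i _ => by ring
    omega
  have hnn : ∀ i, 0 ≤ 2 * (j i * j i) + j i := by
    intro i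
    rcases le_or_gt 0 (j i) with h | h <;> nlinarith
  have hle : ∀ i, 2 * (j i * j i) + j i ≤ 3 := fun i => by
    rw [← hsum]
    exact Finset.single_le_sum (fun i _ => hnn i) (Finset.mem_univ i)
  have hval : ∀ i, j i = 0 ∨ j i = 1 ∨ j i = -1 := by
    intro i
    have := hle i
    have h1 : j i ≤ 1 := by nlinarith
    have h2 : -1 ≤ j i := by nlinarith
    omega
  by_cases hone : ∃ a, j a = 1
  · obtain ⟨a, ha⟩ := hone
    refine Or.inl ⟨a, funext fun i => ?_⟩
    split_ifs with hi
    · rw [hi, ha]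
    · have h2 := Finset.add_le_sum (f := fun i => 2 * (j i * j i) + j i) (fun i _ => hnn i)
        (Finset.mem_univ a) (Finset.mem_univ i) (Ne.symm hi)
      simp only [hsum, ha] at h2
      have h3 := hnn i
      rcases hval i with h | h | h <;> rw [h] at h2 <;> omega
  · right
    refine ⟨Finset.univ.filter fun i => j i = -1, ?_, ?_⟩
    · have h1 : ∀ i, 2 * (j i * j i) + j i = if j i = -1 then 1 else 0 := by
        intro i
        rcases hval i with h | h | h
        · simp [h]
        · exact absurd ⟨i, h⟩ hone
        · simp [h]
      simp only [h1, Finset.sum_boole] at hsum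
      exact_mod_cast hsum
    · funext i
      simp only [Finset.mem_filter, Finset.mem_univ, true_and]
      rcases hval i with h | h | h
      · simp [h]
      · exact absurd ⟨i, h⟩ hone
      · simp [h]

/-- The vector `(1²³, 5)`, with the entry 5 at infinity. -/
def fiveVec : Fin 24 → ℤ := fun i => if i = 23 then 5 else 1

lemma leechEquiv_fiveVec_of_single (a : Fin 24) :
    LeechEquiv (intVec fun i => 1 + 4 * (if i = a then 1 else 0)) (intVec fiveVec) := by
  obtain ⟨π, hπ, ha⟩ := exists_golayAut_apply_eq_infinity a
  convert LeechEquiv.comp_perm _ (golayAut.inv_mem hπ) using 2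
  funext i
  have : (π⁻¹ i = a) ↔ i = 23 := by rw [← ha, Equiv.Perm.inv_eq_iff_eq, eq_comm]
  simp only [fiveVec, Function.comp_apply, this]
  split_ifs <;> rfl

/-- The automorphism group of the Leech lattice is transitive on the vectors of shell 3. -/
lemma leechEquiv_fiveVec {x : Fin 24 → ℤ} (hx : IsLeech x) (h48 : x ⬝ᵥ x = 48) :
    LeechEquiv (intVec x) (intVec fiveVec) := by
  obtain ⟨j, hj⟩ := exists_leechEquiv_one_mod_four hx h48
  refine hj.trans ?_
  have hL := hj.isLeech hx
  rcases shape_of_one_mod_four (hj.dotProduct_self.trans h48) with ⟨a, rfl⟩ | ⟨S, hS, rfl⟩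
  · exact leechEquiv_fiveVec_of_single a
  · obtain ⟨a, b, c, hab, hac, hbc, rfl⟩ := Finset.card_eq_three.1 hS
    obtain ⟨π, hπ, himg⟩ := exists_golayAut_triple hab hac hbc
    have h1 := LeechEquiv.comp_perm
      (fun i => 1 + 4 * (if i ∈ ({a, b, c} : Finset (Fin 24)) then -1 else 0))
      (golayAut.inv_mem hπ)
    have h2 : (fun i => 1 + 4 * (if i ∈ ({a, b, c} : Finset (Fin 24)) then (-1 : ℤ) else 0)) ∘
        ⇑π⁻¹ = fun i => if i ∈ ({23, 0, 1} : Finset (Fin 24)) then -3 else 1 := by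
      funext i
      have : π⁻¹ i ∈ ({a, b, c} : Finset (Fin 24)) ↔ i ∈ ({23, 0, 1} : Finset (Fin 24)) := by
        rw [← himg, ← π.injective.mem_finset_image, ← Equiv.Perm.mul_apply,
          mul_inv_cancel, Equiv.Perm.one_apply]
      simp only [Function.comp_apply, this]
      split_ifs <;> rfl
    rw [h2] at h1
    -- On the tetrad the sextet map yields `-1` three times and `-5`, and `-1` elsewhere.
    have h3 := LeechEquiv.sextetMap (h1.isLeech hL)
    have h4 := LeechEquiv.signChange ones_mem_golayCode ((h1.trans h3).isLeech hL)
    have h5 : signChange 1 (sextetMap fun i => if i ∈ ({23, 0, 1} : Finset (Fin 24)) then -3 else 1)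
        = fun i => 1 + 4 * (if i = 2 then 1 else 0) := by decide +kernel
    rw [h5] at h4
    exact ((h1.trans h3).trans h4).trans (leechEquiv_fiveVec_of_single 2)

/-! ### Decompositions into two minimal vectors -/

/-- The vectors `y` of `Λ(2)` such that `x - y` lies in `Λ(2)` too, for `x` in `Λ(3)`. The
condition on `x - y` amounts to `y · x = 24`. -/
def IsSummand (x y : Fin 24 → ℤ) : Prop := IsLeech y ∧ y ⬝ᵥ y = 32 ∧ y ⬝ᵥ x = 24

lemma IsSummand.sub {x y : Fin 24 → ℤ} (hx : IsLeech x) (h48 : x ⬝ᵥ x = 48)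
    (h : IsSummand x y) : IsSummand x (x - y) := by
  obtain ⟨hy, h32, h24⟩ := h
  refine ⟨hx.sub hy, ?_, ?_⟩ <;>
    simp only [sub_dotProduct, dotProduct_sub, dotProduct_comm x y, h48, h32, h24] <;> norm_num

lemma mem_differenceSet_iff {x : Fin 24 → ℤ} (hx : IsLeech x) (h48 : x ⬝ᵥ x = 48)
    {u : EuclideanSpace ℝ (Fin 24)} :
    u ∈ differenceSet (intVec x) ↔ ∃ y, IsSummand x y ∧ u = intVec (2 • y - x) := by
  constructor
  · rintro ⟨_, hy, _, hz, hv, hu⟩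
    obtain ⟨y, hyL, hyn, rfl⟩ := mem_leechShell_iff.1 hy
    obtain ⟨z, hzL, hzn, rfl⟩ := mem_leechShell_iff.1 hz
    rw [← intVec_add] at hv
    obtain rfl := intVec_injective hv
    have hs : IsSummand (y + z) y := by
      refine ⟨hyL, by simpa using hyn, ?_⟩
      simp only [dotProduct_add, add_dotProduct, dotProduct_comm z y] at h48 ⊢
      push_cast at hyn hzn
      linarith
    rcases hu with rfl | rfl
    · refine ⟨y, hs, ?_⟩
      rw [← intVec_sub]
      congr 1
      rw [two_smul]
      abel
    · refine ⟨y + z - y, hs.sub hx h48, ?_⟩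
      rw [← intVec_sub, ← intVec_neg]
      congr 1
      rw [two_smul]
      abel
  · rintro ⟨y, hy, rfl⟩
    have hz := hy.sub hx h48
    refine ⟨intVec y, mem_leechShell_iff.2 ⟨y, hy.1, by simpa using hy.2.1, rfl⟩, intVec (x - y),
      mem_leechShell_iff.2 ⟨x - y, hz.1, by simpa using hz.2.1, rfl⟩, ?_, Or.inl ?_⟩
    · rw [← intVec_add, add_sub_cancel]
    · rw [← intVec_sub]
      congr 1
      rw [two_smul]
      abel

lemma differenceSet_subset {x : Fin 24 → ℤ} (hx : IsLeech x) (h48 : x ⬝ᵥ x = 48) :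
    differenceSet (intVec x) ⊆ leechShell 5 := by
  intro u hu
  obtain ⟨y, ⟨hy, h32, h24⟩, rfl⟩ := (mem_differenceSet_iff hx h48).1 hu
  refine mem_leechShell_iff.2 ⟨_, ?_, ?_, rfl⟩
  · rw [two_smul]
    exact (hy.add hy).sub hx
  · simp only [two_smul, sub_dotProduct, dotProduct_sub, add_dotProduct, dotProduct_add,
      dotProduct_comm x y, h48, h32, h24]
    norm_num

lemma neg_mem_differenceSet {v u : EuclideanSpace ℝ (Fin 24)} (hu : u ∈ differenceSet v) :
    -u ∈ differenceSet v := by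
  obtain ⟨y, hy, z, hz, hv, rfl | rfl⟩ := hu
  · exact ⟨y, hy, z, hz, hv, Or.inr rfl⟩
  · exact ⟨y, hy, z, hz, hv, Or.inl (neg_neg _)⟩

lemma inner_eq_zero_of_mem_differenceSet {x : Fin 24 → ℤ} (hx : IsLeech x) (h48 : x ⬝ᵥ x = 48)
    {u : EuclideanSpace ℝ (Fin 24)} (hu : u ∈ differenceSet (intVec x)) : ⟪u, intVec x⟫ = 0 := by
  obtain ⟨y, ⟨hy, h32, h24⟩, rfl⟩ := (mem_differenceSet_iff hx h48).1 hu
  rw [inner_intVec, two_smul, sub_dotProduct, add_dotProduct, h24, h48]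
  norm_num

/-- Distinct minimal vectors have inner product at most 16. -/
lemma IsLeech.dotProduct_le {y z : Fin 24 → ℤ} (hy : IsLeech y) (hz : IsLeech z)
    (hy' : y ⬝ᵥ y = 32) (hz' : z ⬝ᵥ z = 32) (h : y ≠ z) : y ⬝ᵥ z ≤ 16 := by
  have := (hy.sub hz).le_dotProduct_self (sub_ne_zero.2 h)
  simp only [sub_dotProduct, dotProduct_sub, dotProduct_comm z y, hy', hz'] at this
  linarith

/-- The inner product of two minimal summands `y`, `y'` of `x` is 8 or 16 unless `y' = y` or
`y' = x - y`, whence the inner product `4 (y · y') - 48` of the differences is `±16`. -/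
lemma abs_inner_of_mem_differenceSet {x : Fin 24 → ℤ} (hx : IsLeech x) (h48 : x ⬝ᵥ x = 48)
    {a b : EuclideanSpace ℝ (Fin 24)} (ha : a ∈ differenceSet (intVec x))
    (hb : b ∈ differenceSet (intVec x)) (hab : a ≠ b) (hab' : a ≠ -b) :
    |⟪a, b⟫| = 1 / 5 * (‖a‖ * ‖b‖) := by
  have hn : ∀ a ∈ differenceSet (intVec x), ‖a‖ = √80 := by
    intro a ha
    have h5 := (differenceSet_subset hx h48 ha).2
    rw [real_inner_self_eq_norm_sq] at h5
    rw [← Real.sqrt_sq (norm_nonneg a), h5]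
    norm_num
  rw [hn a ha, hn b hb, Real.mul_self_sqrt (by norm_num)]
  obtain ⟨y, hy, rfl⟩ := (mem_differenceSet_iff hx h48).1 ha
  obtain ⟨z, hz, rfl⟩ := (mem_differenceSet_iff hx h48).1 hb
  have hw := hz.sub hx h48
  have h1 : y ⬝ᵥ z ≤ 16 := hy.1.dotProduct_le hz.1 hy.2.1 hz.2.1 fun h => hab (by rw [h])
  have h2 : y ⬝ᵥ (x - z) ≤ 16 := hy.1.dotProduct_le hw.1 hy.2.1 hw.2.1 fun h => hab' (by
    rw [h, ← intVec_neg]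
    congr 1
    rw [two_smul, two_smul]
    abel)
  rw [dotProduct_sub, hy.2.2] at h2
  have h3 := hy.1.eight_dvd_dotProduct hz.1
  have h4 : (2 • y - x) ⬝ᵥ (2 • z - x) = 4 * (y ⬝ᵥ z) - 48 := by
    simp only [two_smul, sub_dotProduct, dotProduct_sub, add_dotProduct, dotProduct_add,
      dotProduct_comm x z, h48, hy.2.2, hz.2.2]
    ring
  rw [inner_intVec, h4]
  obtain h | h : y ⬝ᵥ z = 8 ∨ y ⬝ᵥ z = 16 := by omega
  all_goals
    rw [h]
    norm_num

lemma lattice276_le {x : Fin 24 → ℤ} (hx : IsLeech x) (h48 : x ⬝ᵥ x = 48) :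
    lattice276 (intVec x) ≤ leechLattice :=
  Submodule.span_le.2 fun _ hu => (differenceSet_subset hx h48 hu).1

lemma image_differenceSet {g : EuclideanSpace ℝ (Fin 24) ≃ₗᵢ[ℝ] EuclideanSpace ℝ (Fin 24)}
    (hg : ∀ x, g x ∈ leechLattice ↔ x ∈ leechLattice) (v : EuclideanSpace ℝ (Fin 24)) :
    g '' differenceSet v = differenceSet (g v) := by
  have hs : ∀ n x, g x ∈ leechShell n ↔ x ∈ leechShell n := fun n x => by
    simp only [leechShell, Set.mem_ofPred_eq, hg, g.inner_map_map]
  ext u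
  constructor
  · rintro ⟨_, ⟨y, hy, z, hz, rfl, hu⟩, rfl⟩
    refine ⟨g y, (hs _ _).2 hy, g z, (hs _ _).2 hz, map_add g y z, ?_⟩
    rcases hu with rfl | rfl
    · exact Or.inl (map_sub g y z)
    · exact Or.inr (by rw [map_neg, map_sub])
  · rintro ⟨y, hy, z, hz, hv, hu⟩
    refine ⟨g.symm u, ⟨g.symm y, ?_, g.symm z, ?_, ?_, ?_⟩, g.apply_symm_apply u⟩
    · rwa [← hs, g.apply_symm_apply]
    · rwa [← hs, g.apply_symm_apply]
    · rw [← map_add, ← hv, g.symm_apply_apply]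
    · rw [← map_sub, ← map_neg, g.symm.injective.eq_iff, g.symm.injective.eq_iff]
      exact hu

lemma ncard_differenceSet_congr {v w : EuclideanSpace ℝ (Fin 24)} (h : LeechEquiv v w) :
    (differenceSet v).ncard = (differenceSet w).ncard := by
  obtain ⟨g, hg, rfl⟩ := h
  rw [← image_differenceSet hg, Set.ncard_image_of_injective _ g.injective]

/-! ### The number of decompositions of `(1²³, 5)` -/

lemma isLeech_fiveVec : IsLeech fiveVec := by
  refine ⟨1, fun i => if i = 23 then 2 else 0, by decide, ?_, by decide⟩
  have : reduceTwo (fun i => if i = 23 then 2 else 0) = 0 := by decide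
  rw [this]
  exact golayCode.zero_mem

lemma fiveVec_dotProduct_self : fiveVec ⬝ᵥ fiveVec = 48 := by decide +kernel

lemma dotProduct_fiveVec (y : Fin 24 → ℤ) : y ⬝ᵥ fiveVec = ∑ i, y i + 4 * y 23 := by
  have : ∀ i, y i * fiveVec i = y i + if i = 23 then 4 * y i else 0 := by
    intro i
    simp only [fiveVec]
    split_ifs <;> ring
  simp only [dotProduct, this, Finset.sum_add_distrib, Finset.sum_ite_eq', Finset.mem_univ, if_true]

/-- The vector with the entries 2 on a word and 0 elsewhere. -/
def twiceWord (c : Fin 24 → ZMod 2) : Fin 24 → ℤ := fun i => 2 * ((c i).val : ℤ)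

/-- The vector `(4², 0²²)` on the pair of infinity and `a`. -/
def fourPair (a : Fin 24) : Fin 24 → ℤ := fun i => if i = 23 ∨ i = a then 4 else 0

lemma isSummand_twiceWord {c : Fin 24 → ZMod 2} (hc : c ∈ golayCode) (h8 : weight c = 8)
    (h23 : c 23 = 1) : IsSummand fiveVec (twiceWord c) := by
  have hsum : ∑ i, ((c i).val : ℤ) = 8 := by rw [← Nat.cast_sum]; exact_mod_cast h8
  refine ⟨⟨0, fun i => ((c i).val : ℤ), fun i => (zero_add _).symm, ?_, ?_⟩, ?_, ?_⟩
  · convert hc using 1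
    funext i
    simp [reduceTwo]
  · rw [hsum]
    norm_num
  · have : ∀ a : ZMod 2, 2 * (a.val : ℤ) * (2 * (a.val : ℤ)) = 4 * a.val := by decide
    simp only [dotProduct, twiceWord, this, ← Finset.mul_sum, hsum]
    norm_num
  · rw [dotProduct_fiveVec]
    simp only [twiceWord, ← Finset.mul_sum, hsum, h23]
    decide

lemma isSummand_fourPair {a : Fin 24} (ha : a ≠ 23) : IsSummand fiveVec (fourPair a) := by
  refine ⟨⟨0, fun i => if i = 23 ∨ i = a then 2 else 0, fun i => ?_, ?_, ?_⟩, ?_, ?_⟩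
  · simp only [fourPair]
    split_ifs <;> rfl
  · have : reduceTwo (fun i => if i = 23 ∨ i = a then 2 else 0) = 0 := by
      funext i
      simp only [reduceTwo]
      split_ifs <;> rfl
    rw [this]
    exact golayCode.zero_mem
  · revert a
    decide +kernel
  · revert a
    decide +kernel
  · revert a
    decide +kernel

/-- The even summands of `(1²³, 5)` belong to the octads through infinity and to the pairs
containing infinity. With `y = 2k`, the conditions are `k · k = 8` and `∑ i, k i + 4 k∞ = 12`, hence
`∑ i, (k i ² - k i) = 4 k∞ - 4` with nonnegative summands, which forces `k∞ = 1` or `k∞ = 2`. -/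
lemma even_summand_cases {y : Fin 24 → ℤ} (hy : IsSummand fiveVec y) (heven : ∀ i, 2 ∣ y i) :
    (∃ c ∈ golayCode, weight c = 8 ∧ c 23 = 1 ∧ twiceWord c = y) ∨
      ∃ a, a ≠ 23 ∧ fourPair a = y := by
  obtain ⟨hL, h32, h24⟩ := hy
  obtain ⟨m, k, hm, hyk, hk, -⟩ := hL.normal_form
  have hm0 : m = 0 := by
    have := heven 0
    rw [hyk 0] at this
    omega
  simp only [hm0, zero_add] at hyk
  obtain rfl : y = fun i => 2 * k i := funext hyk
  rw [dotProduct_two_mul] at h32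
  rw [dotProduct_fiveVec, sum_two_mul] at h24
  have hnn : ∀ a : ℤ, 0 ≤ a * a - a := fun a => by
    rcases le_or_gt a 0 with h | h <;> nlinarith
  have hsum : ∑ i, (k i * k i - k i) = 4 * k 23 - 4 := by
    rw [Finset.sum_sub_distrib]
    change k ⬝ᵥ k - _ = _
    linarith
  have h1 : k 23 * k 23 - k 23 ≤ 4 * k 23 - 4 := by
    rw [← hsum]
    exact Finset.single_le_sum (f := fun i => k i * k i - k i) (fun i _ => hnn (k i))
      (Finset.mem_univ 23)
  have h2 : k 23 * k 23 ≤ 8 := by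
    have : k ⬝ᵥ k = 8 := by linarith
    rw [← this]
    exact Finset.single_le_sum (f := fun i => k i * k i) (fun i _ => mul_self_nonneg (k i))
      (Finset.mem_univ 23)
  have hzo : ∀ l : Fin 24 → ℤ, ∑ i, (l i * l i - l i) = 0 → ∀ i, l i = 0 ∨ l i = 1 := by
    intro l hl i
    have := (Finset.sum_eq_zero_iff_of_nonneg fun i _ => hnn (l i)).1 hl i (Finset.mem_univ i)
    rcases mul_eq_zero.1 (show l i * (l i - 1) = 0 by linarith) with h | h
    · exact Or.inl h
    · exact Or.inr (by linarith)
  obtain h23 | h23 : k 23 = 1 ∨ k 23 = 2 := by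
    have : 1 ≤ k 23 := by nlinarith
    have : k 23 < 3 := by nlinarith
    omega
  · left
    rw [h23] at hsum
    have h01 := hzo k (by simpa using hsum)
    have hval : ∀ i, ((reduceTwo k i).val : ℤ) = k i := fun i => by
      simp only [reduceTwo]
      rcases h01 i with h | h <;> rw [h] <;> rfl
    refine ⟨reduceTwo k, hk, ?_, ?_, ?_⟩
    · rw [weight]
      zify
      simp only [hval]
      linarith
    · simp [reduceTwo, h23]
    · funext i
      simp only [twiceWord, hval]
  · right
    -- The coordinate at infinity is even and takes up 4 of the norm 8.
    have hw : weight (reduceTwo k) < 8 := by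
      have h3 : (∑ i, (k i * k i - ((k i : ZMod 2).val : ℤ))) = 8 - weight (reduceTwo k) := by
        rw [Finset.sum_sub_distrib, weight, Nat.cast_sum]
        change k ⬝ᵥ k - _ = _
        rw [show k ⬝ᵥ k = 8 by linarith]
        rfl
      have h4 := Finset.single_le_sum (f := fun i => k i * k i - ((k i : ZMod 2).val : ℤ))
        (fun i _ => sub_nonneg.2 (val_le_sq (k i))) (Finset.mem_univ 23)
      simp only [h3, h23] at h4
      have h5 : (((2 : ℤ) : ZMod 2).val : ℤ) = 0 := rfl
      rw [h5] at h4
      omega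
    have h0 : reduceTwo k = 0 := by
      have h3 := weight_golayCode hk
      simp only [List.mem_cons, List.not_mem_nil, or_false] at h3
      exact weight_eq_zero (by omega)
    obtain ⟨l, rfl⟩ := exists_eq_two_mul h0
    rw [dotProduct_two_mul] at h32
    rw [sum_two_mul] at h24
    have h01 := hzo l (by
      rw [Finset.sum_sub_distrib]
      change l ⬝ᵥ l - _ = _
      linarith)
    have hl : ∀ i, l i = if l i = 1 then 1 else 0 := fun i => by
      rcases h01 i with h | h <;> simp [h]
    have hcard : (Finset.univ.filter fun i => l i = 1).card = 2 := by
      have h3 : ∑ i, l i = 2 := by linarith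
      rw [Finset.sum_congr rfl fun i _ => hl i, Finset.sum_boole] at h3
      exact_mod_cast h3
    obtain ⟨p, q, hpq, hset⟩ := Finset.card_eq_two.1 hcard
    have hmem : ∀ i, l i = 1 ↔ i = p ∨ i = q := fun i => by
      have := congrArg (fun s : Finset (Fin 24) => i ∈ s) hset
      simpa using this
    have hfour : ∀ a, (∀ i, l i = 1 ↔ i = 23 ∨ i = a) → fourPair a = fun i => 2 * (2 * l i) := by
      intro a ha
      funext i
      simp only [fourPair, ← ha]
      rcases h01 i with h | h <;> simp [h]
    rcases (hmem 23).1 (by linarith) with h | h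
    · exact ⟨q, fun h' => hpq (h.symm.trans h'.symm), hfour q fun i => by rw [hmem, h]⟩
    · exact ⟨p, fun h' => hpq (h'.trans h), hfour p fun i => by rw [hmem, h, or_comm]⟩

lemma twiceWord_injective : Function.Injective twiceWord := by
  intro c d h
  funext i
  have := congrFun h i
  simp only [twiceWord] at this
  exact ZMod.val_injective 2 (by omega)

/-- There are 253 + 23 even summands. -/
lemma ncard_even_summands : {y | IsSummand fiveVec y ∧ ∀ i, 2 ∣ y i}.ncard = 276 := by
  have hset : {y | IsSummand fiveVec y ∧ ∀ i, 2 ∣ y i} =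
      twiceWord '' {c | c ∈ golayCode ∧ weight c = 8 ∧ c 23 = 1} ∪ fourPair '' {a | a ≠ 23} := by
    ext y
    constructor
    · rintro ⟨hy, he⟩
      rcases even_summand_cases hy he with ⟨c, hc, h8, h23, rfl⟩ | ⟨a, ha, rfl⟩
      · exact Or.inl ⟨c, ⟨hc, h8, h23⟩, rfl⟩
      · exact Or.inr ⟨a, ha, rfl⟩
    · rintro (⟨c, ⟨hc, h8, h23⟩, rfl⟩ | ⟨a, ha, rfl⟩)
      · exact ⟨isSummand_twiceWord hc h8 h23, fun i => ⟨_, rfl⟩⟩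
      · refine ⟨isSummand_fourPair ha, fun i => ?_⟩
        simp only [fourPair]
        split_ifs <;> decide
  rw [hset, Set.ncard_union_eq _ (Set.toFinite _) (Set.toFinite _),
    Set.ncard_image_of_injective _ twiceWord_injective, ncard_octads_infinity,
    Set.InjOn.ncard_image]
  · have : {a : Fin 24 | a ≠ 23} = ((Finset.univ.erase 23 : Finset (Fin 24)) : Set (Fin 24)) := by
      ext a
      simp
    rw [this, Set.ncard_coe_finset]
    decide
  · intro a ha b hb h
    have := congrFun h a
    simp only [fourPair, or_true, if_true] at this
    by_contra hne
    rw [if_neg (by simpa using ⟨ha, hne⟩)] at this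
    norm_num at this
  · rw [Set.disjoint_left]
    rintro _ ⟨c, -, rfl⟩ ⟨a, -, h⟩
    have h1 := congrFun h 23
    have h2 : (c 23).val < 2 := ZMod.val_lt _
    simp only [fourPair, true_or, if_true, twiceWord] at h1
    omega

lemma ncard_differenceSet_fiveVec : (differenceSet (intVec fiveVec)).ncard = 2 * 276 := by
  let E := {y | IsSummand fiveVec y ∧ ∀ i, 2 ∣ y i}
  let G : (Fin 24 → ℤ) → EuclideanSpace ℝ (Fin 24) := fun y => intVec (2 • y - fiveVec)
  have hG : Function.Injective G := fun y z h => by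
    have h1 := intVec_injective h
    funext i
    have h2 := congrFun h1 i
    simp only [two_smul, Pi.sub_apply, Pi.add_apply] at h2
    omega
  have hneg : ∀ y, G (fiveVec - y) = -G y := fun y => by
    simp only [G]
    rw [← intVec_neg]
    congr 1
    rw [two_smul, two_smul]
    abel
  have hset : differenceSet (intVec fiveVec) = G '' E ∪ (fun u => -u) '' (G '' E) := by
    ext u
    rw [mem_differenceSet_iff isLeech_fiveVec fiveVec_dotProduct_self]
    constructor
    · rintro ⟨y, hy, rfl⟩
      obtain ⟨m, k, rfl | rfl, hyk, -, -⟩ := hy.1.normal_form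
      · exact Or.inl ⟨y, ⟨hy, fun i => ⟨k i, by rw [hyk]; ring⟩⟩, rfl⟩
      · refine Or.inr ⟨_, ⟨fiveVec - y, ⟨hy.sub isLeech_fiveVec fiveVec_dotProduct_self,
          fun i => ?_⟩, rfl⟩, ?_⟩
        · simp only [Pi.sub_apply, hyk, fiveVec]
          split_ifs <;> omega
        · rw [hneg]
          exact neg_neg _
    · rintro (⟨y, hy, rfl⟩ | ⟨_, ⟨y, hy, rfl⟩, rfl⟩)
      · exact ⟨y, hy.1, rfl⟩
      · exact ⟨fiveVec - y, hy.1.sub isLeech_fiveVec fiveVec_dotProduct_self, (hneg y).symm⟩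
  have hE : (G '' E).ncard = 276 := by
    rw [Set.ncard_image_of_injective _ hG]
    exact ncard_even_summands
  have hfin : (G '' E).Finite := Set.finite_of_ncard_ne_zero (by rw [hE]; norm_num)
  rw [hset, Set.ncard_union_eq _ hfin (hfin.image _), Set.ncard_image_of_injective _ neg_injective,
    hE]
  rw [Set.disjoint_left]
  rintro _ ⟨y, ⟨-, hy⟩, rfl⟩ ⟨_, ⟨z, ⟨-, hz⟩, rfl⟩, h⟩
  dsimp only at h
  rw [← hneg] at h
  have h1 := congrFun (hG h) 0
  have h2 := hy 0
  have h3 := hz 0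
  simp only [Pi.sub_apply, fiveVec] at h1
  rw [if_neg (by decide)] at h1
  omega

/-! ### Projections to `E₈` -/

lemma image_lattice276 {g : EuclideanSpace ℝ (Fin 24) ≃ₗᵢ[ℝ] EuclideanSpace ℝ (Fin 24)}
    (hg : ∀ x, g x ∈ leechLattice ↔ x ∈ leechLattice) (v : EuclideanSpace ℝ (Fin 24)) :
    g '' (lattice276 v : Set (EuclideanSpace ℝ (Fin 24))) = lattice276 (g v) := by
  have h := Submodule.map_span (g.toLinearEquiv.toAddEquiv.toAddMonoidHom.toIntLinearMap)
    (differenceSet v)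
  rw [lattice276, lattice276, ← image_differenceSet hg]
  exact congrArg SetLike.coe h

/-- A multiple of the projection of `lattice276 v` to some 8-dimensional subspace is `E₈`. The
subspace is encoded by an isometric embedding, whose adjoint is the projection in the coordinates
of the subspace. -/
def ProjectsToE8 (v : EuclideanSpace ℝ (Fin 24)) : Prop :=
  ∃ (ι : EuclideanSpace ℝ (Fin 8) →ₗᵢ[ℝ] EuclideanSpace ℝ (Fin 24)) (c : ℝ), 0 < c ∧
    (fun x => c • ι.toLinearMap.adjoint x) '' (lattice276 v : Set (EuclideanSpace ℝ (Fin 24))) =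
      latticeE8

lemma ProjectsToE8.congr {v w : EuclideanSpace ℝ (Fin 24)} (h : LeechEquiv v w)
    (hv : ProjectsToE8 v) : ProjectsToE8 w := by
  obtain ⟨g, hg, rfl⟩ := h
  obtain ⟨ι, c, hc, himg⟩ := hv
  refine ⟨g.toLinearIsometry.comp ι, c, hc, ?_⟩
  rw [← image_lattice276 hg, Set.image_image, ← himg]
  refine Set.image_congr fun x _ => ?_
  congr 1
  refine ext_inner_left ℝ fun y => ?_
  rw [LinearMap.adjoint_inner_right, LinearMap.adjoint_inner_right]
  exact g.inner_map_map (ι y) x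

/-- The range of the embedding is the subspace, and the inverse of the embedding its isometry with
the standard space. -/
lemma ProjectsToE8.exists_submodule {v : EuclideanSpace ℝ (Fin 24)} (hv : ProjectsToE8 v) :
    ∃ W : Submodule ℝ (EuclideanSpace ℝ (Fin 24)), Module.finrank ℝ W = 8 ∧
      ∃ (c : ℝ) (φ : W ≃ₗᵢ[ℝ] EuclideanSpace ℝ (Fin 8)), 0 < c ∧
        (fun x => c • φ (W.orthogonalProjectionOnto x)) ''
          (lattice276 v : Set (EuclideanSpace ℝ (Fin 24))) = latticeE8 := by
  obtain ⟨ι, c, hc, himg⟩ := hv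
  refine ⟨ι.toLinearMap.range, ?_, c, ι.equivRange.symm, hc, ?_⟩
  · rw [LinearMap.finrank_range_of_inj ι.injective, finrank_euclideanSpace_fin]
  · rw [← himg]
    refine Set.image_congr fun x _ => ?_
    congr 1
    refine ext_inner_left ℝ fun y => ?_
    rw [LinearMap.adjoint_inner_right, ← ι.equivRange.inner_map_map y,
      LinearIsometryEquiv.apply_symm_apply]
    exact Submodule.inner_orthogonalProjectionOnto_eq_of_mem_left (ι.equivRange y) x

/-! ### The projection to an octad -/

/-- An enumeration of an octad. -/
def octadPoint (j : Fin 8) : Fin 24 := ([0, 2, 13, 14, 15, 16, 17, 20] : List (Fin 24)).getD j 0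

lemma octadPoint_injective : Function.Injective octadPoint := by decide +kernel

/-- The isometric embedding onto the vectors supported on the octad. -/
def octadEmbedding : EuclideanSpace ℝ (Fin 8) →ₗᵢ[ℝ] EuclideanSpace ℝ (Fin 24) where
  toFun y := WithLp.toLp 2 fun i => ∑ j, if octadPoint j = i then y j else 0
  map_add' x y := by
    ext i
    simp only [PiLp.add_apply, ← Finset.sum_add_distrib]
    exact Finset.sum_congr rfl fun j _ => by split_ifs <;> simp
  map_smul' a x := by
    ext i
    simp [Finset.mul_sum]
  norm_map' y := by
    have h : ∀ j, (∑ l, if octadPoint l = octadPoint j then y l else 0) = y j := fun j => by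
      simp [octadPoint_injective.eq_iff]
    have h0 : ∀ i, i ∉ Set.range octadPoint → (∑ l, if octadPoint l = i then y l else 0) = 0 :=
      fun i hi => Finset.sum_eq_zero fun l _ => if_neg fun h => hi ⟨l, h⟩
    rw [EuclideanSpace.norm_eq, EuclideanSpace.norm_eq]
    congr 1
    symm
    refine Finset.sum_of_injOn octadPoint octadPoint_injective.injOn (by simp) ?_ ?_
    · intro i _ hi
      have := h0 i (by simpa using hi)
      simp [this]
    · intro j _
      simp only [LinearMap.coe_mk, AddHom.coe_mk, h]

lemma adjoint_octadEmbedding (x : EuclideanSpace ℝ (Fin 24)) :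
    octadEmbedding.toLinearMap.adjoint x = WithLp.toLp 2 fun j => x (octadPoint j) := by
  refine ext_inner_left ℝ fun y => ?_
  rw [LinearMap.adjoint_inner_right]
  simp only [PiLp.inner_apply, octadEmbedding, LinearMap.coe_mk, AddHom.coe_mk]
  simp only [RCLike.inner_apply, conj_trivial, Finset.mul_sum, mul_ite, mul_zero]
  rw [Finset.sum_comm]
  simp

/-- A vector of shell 3 of shape `(4, 2⁷, -2, 0¹⁵)`: its entries `±2` occupy an octad, its entry 4
lies outside that octad and the octad enumerated by `octadPoint`, and it vanishes on the latter. -/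
def trioVec : Fin 24 → ℤ := fun i =>
  ([0, -2, 0, 2, 4, 2, 0, 0, 2, 0, 0, 0, 0, 0, 0, 0, 0, 0, 2, 2, 0, 2, 0, 2] : List ℤ).getD i 0

/-- The indicator of the parities of an integer vector, as a number in binary. -/
def parityBits (k : Fin 24 → ℤ) : ℕ :=
  (List.finRange 24).foldr (fun i u => 2 * u + (k i % 2).toNat) 0

lemma reduceTwo_mem_of_parityBits {k : Fin 24 → ℤ}
    (h : ∀ i, (k i % 2).toNat = ((parityBits k).testBit i).toNat)
    (h' : golayReduce (parityBits k) golayBasis = 0) : reduceTwo k ∈ golayCode := by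
  have : reduceTwo k = bitVec (parityBits k) := by
    funext i
    have h1 := h i
    simp only [reduceTwo, bitVec]
    rcases Int.emod_two_eq_zero_or_one (k i) with h2 | h2
    · rw [h2] at h1
      rw [(ZMod.intCast_zmod_eq_zero_iff_dvd _ 2).2 (by push_cast; omega)]
      cases h3 : (parityBits k).testBit i
      · simp
      · simp [h3] at h1
    · rw [h2] at h1
      cases h3 : (parityBits k).testBit i
      · simp [h3] at h1
      · obtain ⟨a, ha⟩ : ∃ a, k i = 2 * a + 1 := ⟨k i / 2, by omega⟩
        rw [ha]
        push_cast
        rw [show (2 : ZMod 2) = 0 from rfl]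
        simp
  rw [this]
  exact bitVec_mem_golayCode h'

lemma isLeech_trioVec : IsLeech trioVec :=
  ⟨0, fun i => ([0, -1, 0, 1, 2, 1, 0, 0, 1, 0, 0, 0, 0, 0, 0, 0, 0, 0, 1, 1, 0, 1, 0, 1] :
    List ℤ).getD i 0, by decide +kernel,
    reduceTwo_mem_of_parityBits (by decide +kernel) (by decide +kernel), by decide +kernel⟩

lemma trioVec_dotProduct_self : trioVec ⬝ᵥ trioVec = 48 := by decide +kernel

/-- Halves of summands of `trioVec`: entries `±1` on an octad that meets the octad of
`octadPoint` in two points, the octad of the entries `±2` in four, and the third octad of the trio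
in two, one of which is the point of the entry 4. On the octad of `octadPoint` they restrict to the
roots `e₀ - e₁` and `e₀ + eⱼ`. -/
def halfSummand (j : Fin 8) : Fin 24 → ℤ := fun i =>
  (([
    [1, -1, -1, 0, 1, 1, 0, 0, 0, 1, 0, 0, 0, 0, 0, 0, 0, 0, 1, 1, 0, 0, 0, 0],
    [1, -1, 1, 0, 1, 1, 0, 0, 0, -1, 0, 0, 0, 0, 0, 0, 0, 0, 1, 1, 0, 0, 0, 0],
    [1, 0, 0, 1, 1, 1, 0, 0, 0, 0, 0, 0, 1, 1, 0, 0, 0, 0, 1, 0, 0, 0, 0, 1],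
    [1, -1, 0, 0, 1, 0, 0, 0, 0, 0, -1, 0, 0, 0, 1, 0, 0, 0, 1, 0, 0, 1, 0, 1],
    [1, 0, 0, 1, 1, 0, 0, 1, 0, 0, 0, 0, 0, 0, 0, 1, 0, 0, 1, 1, 0, 1, 0, 0],
    [1, -1, 0, 1, 1, 1, -1, 0, 0, 0, 0, 0, 0, 0, 0, 0, 1, 0, 0, 0, 0, 1, 0, 0],
    [1, 0, 0, 0, 1, 1, 0, 0, 0, 0, 0, 0, 0, 0, 0, 0, 0, 1, 0, 1, 0, 1, 1, 1],
    [1, -1, 0, 1, 1, 0, 0, 0, 0, 0, 0, -1, 0, 0, 0, 0, 0, 0, 0, 1, 1, 0, 0, 1]] :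
    List (List ℤ)).getD j []).getD i 0

lemma isSummand_halfSummand (j : Fin 8) : IsSummand trioVec (fun i => 2 * halfSummand j i) := by
  have h1 : ∀ j i, (halfSummand j i % 2).toNat =
    ((parityBits (halfSummand j)).testBit i).toNat := by decide +kernel
  have h2 : ∀ j, golayReduce (parityBits (halfSummand j)) golayBasis = 0 := by decide +kernel
  have h3 : ∀ j, 4 ∣ ∑ i, halfSummand j i - 2 * 0 ∧
    (fun i => 2 * halfSummand j i) ⬝ᵥ (fun i => 2 * halfSummand j i) = 32 ∧
    (fun i => 2 * halfSummand j i) ⬝ᵥ trioVec = 24 := by decide +kernel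
  exact ⟨⟨0, halfSummand j, fun i => (zero_add _).symm, reduceTwo_mem_of_parityBits (h1 j) (h2 j),
    (h3 j).1⟩, (h3 j).2⟩

/-- A summand of `trioVec` that projects to the all-ones vector. -/
def oddSummand : Fin 24 → ℤ := fun i => if i = 1 then -3 else 1

lemma isSummand_oddSummand : IsSummand trioVec oddSummand :=
  ⟨⟨1, fun i => if i = 1 then -2 else 0, by decide +kernel,
    reduceTwo_mem_of_parityBits (by decide +kernel) (by decide +kernel), by decide +kernel⟩,
    by decide +kernel, by decide +kernel⟩

lemma halfSummand_octadPoint (j l : Fin 8) : halfSummand j (octadPoint l) =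
    if j = 0 then (if l = 0 then 1 else if l = 1 then -1 else 0)
      else if l = 0 ∨ l = j then 1 else 0 := by
  revert j l
  decide +kernel

lemma oddSummand_octadPoint (l : Fin 8) : oddSummand (octadPoint l) = 1 := by
  revert l
  decide +kernel

lemma trioVec_octadPoint (l : Fin 8) : trioVec (octadPoint l) = 0 := by
  revert l
  decide +kernel

/-- As the projection to the octad kills `trioVec`, the projection of the lattice lies in that of
`2Λ`. -/
lemma exists_two_mul_of_mem_lattice276 {x : EuclideanSpace ℝ (Fin 24)}
    (hx : x ∈ lattice276 (intVec trioVec)) :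
    ∃ y, IsLeech y ∧ ∀ j, x (octadPoint j) = 2 * (y (octadPoint j) : ℝ) := by
  rw [lattice276] at hx
  induction hx using Submodule.span_induction with
  | mem u hu =>
    obtain ⟨y, hy, rfl⟩ := (mem_differenceSet_iff isLeech_trioVec trioVec_dotProduct_self).1 hu
    refine ⟨y, hy.1, fun j => ?_⟩
    rw [intVec_apply, two_smul, Pi.sub_apply, Pi.add_apply, trioVec_octadPoint]
    push_cast
    ring
  | zero =>
    refine ⟨0, ?_, fun j => by simp⟩
    rw [← intVec_mem_leechLattice]
    convert leechLattice.zero_mem using 1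
    ext i
    simp
  | add u w _ _ hu hw =>
    obtain ⟨y, hy, hyu⟩ := hu
    obtain ⟨z, hz, hzw⟩ := hw
    refine ⟨y + z, hy.add hz, fun j => ?_⟩
    rw [PiLp.add_apply, hyu, hzw, Pi.add_apply]
    push_cast
    ring
  | smul a u _ hu =>
    obtain ⟨y, hy, hyu⟩ := hu
    refine ⟨a • y, ?_, fun j => ?_⟩
    · rw [← intVec_mem_leechLattice]
      convert leechLattice.smul_mem a (intVec_mem_leechLattice.2 hy) using 1
      ext i
      simp
    · rw [PiLp.smul_apply, hyu, Pi.smul_apply, zsmul_eq_mul, smul_eq_mul]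
      push_cast
      ring

lemma two_dvd_sum_octadPoint {k : Fin 24 → ℤ} (hk : reduceTwo k ∈ golayCode) :
    2 ∣ ∑ j, k (octadPoint j) := by
  let d : Fin 24 → ℤ := fun i => if i ∈ Finset.univ.image octadPoint then 1 else 0
  have hd : reduceTwo d ∈ golayCode :=
    reduceTwo_mem_of_parityBits (by decide +kernel) (by decide +kernel)
  have h := two_dvd_dotProduct hd hk
  have hs : d ⬝ᵥ k = ∑ j, k (octadPoint j) := by
    simp only [dotProduct, d, ite_mul, one_mul, zero_mul, Finset.sum_ite_mem, Finset.univ_inter]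
    rw [Finset.sum_image octadPoint_injective.injOn]
  rwa [hs] at h

/-- The halves of the restrictions to an octad of the vectors of the Leech lattice lie in `E₈`. -/
lemma half_restrict_mem_latticeE8 {y : Fin 24 → ℤ} (hy : IsLeech y) :
    (WithLp.toLp 2 fun j => (y (octadPoint j) : ℝ) / 2) ∈ latticeE8 := by
  obtain ⟨m, k, hm, hyk, hk, -⟩ := hy.normal_form
  obtain ⟨b, hb⟩ := two_dvd_sum_octadPoint hk
  have hb' : ∑ j, (k (octadPoint j) : ℝ) = 2 * b := by exact_mod_cast hb
  refine ⟨?_, b + 2 * m, ?_⟩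
  · rcases hm with rfl | rfl
    · left
      intro j
      refine ⟨k (octadPoint j), ?_⟩
      change (y (octadPoint j) : ℝ) / 2 = _
      rw [hyk]
      push_cast
      ring
    · right
      intro j
      refine ⟨k (octadPoint j), ?_⟩
      change (y (octadPoint j) : ℝ) / 2 = _
      rw [hyk]
      push_cast
      ring
  · have : ∀ j, (y (octadPoint j) : ℝ) / 2 = m / 2 + k (octadPoint j) := fun j => by
      rw [hyk]
      push_cast
      ring
    simp only [this, Finset.sum_add_distrib, hb', Finset.sum_const, Finset.card_univ,
      Fintype.card_fin, nsmul_eq_mul]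
    push_cast
    ring

/-- The roots `e₀ - e₁`, `e₀ + eⱼ` and the half of the all-ones vector generate `E₈`. -/
lemma mem_of_mem_latticeE8 (L : AddSubgroup (EuclideanSpace ℝ (Fin 8)))
    (hroot : ∀ j : Fin 8, (WithLp.toLp 2 fun l => (((if j = 0 then
      (if l = 0 then 1 else if l = 1 then -1 else 0) else if l = 0 ∨ l = j then 1 else 0 : ℤ)) : ℝ))
      ∈ L)
    (hhalf : (WithLp.toLp 2 fun _ => (1 / 2 : ℝ)) ∈ L) {x : EuclideanSpace ℝ (Fin 8)}
    (hx : x ∈ latticeE8) : x ∈ L := by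
  have key : ∀ (a : Fin 8 → ℤ) (b : ℤ), ∑ i, a i = 2 * b →
      (WithLp.toLp 2 fun i => (a i : ℝ)) ∈ L := by
    intro a b hab
    -- The coefficient of `2 e₀` is `(a₀ - a₁ - ⋯ - a₇) / 2 = a₀ - b`.
    have hmem := L.add_mem (L.zsmul_mem (L.add_mem (hroot 0) (hroot 1)) (a 0 - b))
      (L.sum_mem (t := Finset.univ.erase 0) fun j _ => L.zsmul_mem (hroot j) (a j))
    convert hmem using 1
    have hb : (∑ i, (a i : ℝ)) = 2 * b := by exact_mod_cast hab
    rw [Fin.sum_univ_eight] at hb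
    have he : (Finset.univ.erase 0 : Finset (Fin 8)) = {1, 2, 3, 4, 5, 6, 7} := by decide
    rw [he]
    ext i
    fin_cases i <;> simp
    all_goals linarith
  obtain ⟨hx, b, hb⟩ := hx
  rcases hx with hx | hx
  · choose a ha using hx
    have : x = WithLp.toLp 2 fun i => (a i : ℝ) := by
      ext i
      exact ha i
    rw [this]
    refine key a b ?_
    simp only [ha] at hb
    exact_mod_cast hb
  · choose a ha using hx
    have : x = (WithLp.toLp 2 fun i => (a i : ℝ)) + WithLp.toLp 2 fun _ => (1 / 2 : ℝ) := by
      ext i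
      exact ha i
    rw [this]
    refine L.add_mem (key a (b - 2) ?_) hhalf
    simp only [ha, Finset.sum_add_distrib, Finset.sum_const, Finset.card_univ, Fintype.card_fin,
      nsmul_eq_mul] at hb
    have : (∑ i, (a i : ℝ)) = 2 * (b - 2) := by
      push_cast at hb
      linarith
    exact_mod_cast this

lemma projectsToE8_trioVec : ProjectsToE8 (intVec trioVec) := by
  refine ⟨octadEmbedding, 1 / 4, by norm_num, ?_⟩
  apply Set.Subset.antisymm
  · rintro _ ⟨x, hx, rfl⟩
    obtain ⟨y, hy, hxy⟩ := exists_two_mul_of_mem_lattice276 hx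
    convert half_restrict_mem_latticeE8 hy using 1
    ext j
    simp only [adjoint_octadEmbedding, PiLp.smul_apply, hxy, smul_eq_mul]
    ring
  · intro w hw
    let f : EuclideanSpace ℝ (Fin 24) →+ EuclideanSpace ℝ (Fin 8) :=
      ((1 / 4 : ℝ) • octadEmbedding.toLinearMap.adjoint).toAddMonoidHom
    have hmem : ∀ y, IsSummand trioVec y → (WithLp.toLp 2 fun j => (y (octadPoint j) : ℝ) / 2) ∈
        (lattice276 (intVec trioVec)).toAddSubgroup.map f := by
      intro y hy
      refine ⟨intVec (2 • y - trioVec), Submodule.subset_span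
        ((mem_differenceSet_iff isLeech_trioVec trioVec_dotProduct_self).2 ⟨y, hy, rfl⟩), ?_⟩
      change (1 / 4 : ℝ) • octadEmbedding.toLinearMap.adjoint _ = _
      ext j
      simp only [adjoint_octadEmbedding, PiLp.smul_apply, smul_eq_mul, intVec_apply, two_smul,
        Pi.sub_apply, Pi.add_apply, trioVec_octadPoint]
      push_cast
      ring
    have hw' := mem_of_mem_latticeE8 ((lattice276 (intVec trioVec)).toAddSubgroup.map f)
      (fun j => by
        convert hmem _ (isSummand_halfSummand j) using 2
        funext l
        rw [← halfSummand_octadPoint]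
        push_cast
        ring)
      (by
        convert hmem _ isSummand_oddSummand using 2
        funext l
        rw [oddSummand_octadPoint]
        norm_num) hw
    obtain ⟨x, hx, hxw⟩ := hw'
    exact ⟨x, hx, hxw⟩

/-! ### The theorem -/

theorem theorem5 (v : EuclideanSpace ℝ (Fin 24)) (hv : v ∈ leechShell 3) :
    (differenceSet v ⊆ leechShell 5 ∧
      (differenceSet v).ncard = 2 * 276 ∧
      (∀ a ∈ differenceSet v, -a ∈ differenceSet v) ∧
      (∀ a ∈ differenceSet v, ⟪a, v⟫ = 0) ∧
      (∀ a ∈ differenceSet v, ∀ b ∈ differenceSet v, a ≠ b → a ≠ -b →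
        |⟪a, b⟫| = 1 / 5 * (‖a‖ * ‖b‖))) ∧
    lattice276 v ≤ leechLattice ∧
    ∃ W : Submodule ℝ (EuclideanSpace ℝ (Fin 24)), Module.finrank ℝ W = 8 ∧
      ∃ (c : ℝ) (φ : W ≃ₗᵢ[ℝ] EuclideanSpace ℝ (Fin 8)), 0 < c ∧
        (fun x => c • φ (W.orthogonalProjectionOnto x)) ''
          (lattice276 v : Set (EuclideanSpace ℝ (Fin 24))) = latticeE8 := by
  obtain ⟨x, hx, h48, rfl⟩ := mem_leechShell_iff.1 hv
  norm_num at h48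
  have hequiv := leechEquiv_fiveVec hx h48
  refine ⟨⟨differenceSet_subset hx h48, ?_, fun _ => neg_mem_differenceSet,
    fun _ => inner_eq_zero_of_mem_differenceSet hx h48,
    fun _ ha _ hb => abs_inner_of_mem_differenceSet hx h48 ha hb⟩, lattice276_le hx h48,
    ProjectsToE8.exists_submodule ?_⟩
  · rw [ncard_differenceSet_congr hequiv, ncard_differenceSet_fiveVec]
  · exact projectsToE8_trioVec.congr
      ((leechEquiv_fiveVec isLeech_trioVec trioVec_dotProduct_self).trans hequiv.symm)
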